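/- All vector spaces are complex, $n,m,r,\dots$ range over positive integers, $M_{m,n}(V)$ denotes the $m\times n$ matrices over $V$, $M_n(V)=M_{n,n}(V)$, $M_{m,n}=M_{m,n}(\mathbb C)$, scalar matrices carry the operator norm, $v\oplus w$ is the block-diagonal sum, and $\alpha v\beta$ is the product of $v\in M_{p,q}(V)$ with scalar matrices $\alpha\in M_{m,p}$, $\beta\in M_{q,n}$. **Matrix order unit spaces.** A matrix order unit space $(\mathcal V,1)$ is a complex vector space $\mathcal V$ with a conjugate-linear involution $*$ (and $[v_{ij}]^*=[v_{ji}^*]$ on $M_n(\mathcal V)$), proper convex cones $M_n(\mathcal V)^+\subseteq M_n(\mathcal V)_{sa}$ with $\gamma^*M_n(\mathcal V)^+\gamma\subseteq M_m(\mathcal V)^+$ for $\gamma\in M_{n,m}$, and an element $1=1^*\in\mathcal V$ such that every $v=v^*\in\mathcal V$ satisfies $v\le t1$ for some $t>0$, and such that $v\in M_n(\mathcal V)^+$ whenever $t1_n+v\in M_n(\mathcal V)^+$ for all $t>0$, where $1_n$ is the diagonal matrix with diagonal entries $1$. The space $M_n(\mathcal V)$ has the norm $\|v\|=\inf\{t\ge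 0:\begin{bmatrix}t1_n&v\\v^*&t1_n\end{bmatrix}\ge0\}$. Let $\tilde{\mathcal V}=\mathcal V/\mathbb C1$ with the quotient norm and the induced involution, and let $(\tilde{\mathcal V})^*$ be its normed dual. For $f\in M_n((\tilde{\mathcal V})^*)$, regarded as a map $\tilde{\mathcal V}\to M_n$, put $f^*(x)=f(x^*)^*$. **Matrix states.** $CS_n(\mathcal V)$ is the set of completely bounded, completely positive maps $\varphi:\mathcal V\to M_n$ with $\varphi(1)$ equal to the identity matrix of $M_n$, regarded as a subset of $M_n(\mathcal V^*)$, and $\mathcal{CS}(\mathcal V)=(CS_n(\mathcal V))$. For $\varphi,\psi\in CS_n(\mathcal V)$ the map $\varphi-\psi$ vanishes at $1$ and is regarded as an element of $M_n((\tilde{\mathcal V})^*)$. **Matrix metrics.** A matrix metric $\mathcal D=(D_n)$ on $\mathcal{CS}(\mathcal V)$ is a sequence of (finite) metrics $D_n$ on $CS_n(\mathcal V)$ such that 1. $D_{m+n}(x\oplus y,u\oplus v)=\max\{D_m(x,u),D_n(y,v)\}$ for $x,u\in CS_m(\mathcal V)$ and $y,v\in CS_n(\mathcal V)$ (with $x\oplus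 y,u\oplus v\in CS_{m+n}(\mathcal V)$); 2. $D_n(\alpha^*x\alpha,\alpha^*u\alpha)\le D_m(x,u)$ for $x,u\in CS_m(\mathcal V)$ and $\alpha\in M_{m,n}$ with $\alpha^*\alpha$ the identity (and $\alpha^*x\alpha,\alpha^*u\alpha\in CS_n(\mathcal V)$). It is *convex*, *midpoint balanced* or *midpoint concave* if for every $n$ the metric $\rho=D_n$ satisfies, respectively, for all $x,y,z,u,v\in CS_n(\mathcal V)$ and $t\in[0,1]$: $\rho(x,ty+(1-t)z)\le t\rho(x,y)+(1-t)\rho(x,z)$; $\frac{x+v}2=\frac{y+u}2$ implies $\rho(x,u)=\rho(y,v)$; $\rho(\frac{x+u}2,\frac{y+v}2)\le\frac12(\rho(x,y)+\rho(u,v))$. **Matrix norms.** A matrix norm $\mathcal Q=(Q_n)$ on a vector space $W$ is a sequence of norms $Q_n$ on $M_n(W)$ with $Q_{m+n}(v\oplus w)=\max\{Q_m(v),Q_n(w)\}$ and $Q_n(\alpha v\beta)\le\|\alpha\|Q_m(v)\|\beta\|$ for $v\in M_m(W)$, $w\in M_n(W)$, $\alpha\in M_{n,m}$, $\beta\in M_{m,n}$.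 **Theorem 5.5.** Let $(\mathcal V,1)$ be a matrix order unit space and let $\mathcal D=(D_n)$ be a matrix metric on $\mathcal{CS}(\mathcal V)$. There is a matrix norm $\mathcal Q=(Q_n)$ on $(\tilde{\mathcal V})^*$ such that $$Q_n(\varphi-\psi)=D_n(\varphi,\psi)\quad\text{for all }n\text{ and }\varphi,\psi\in CS_n(\mathcal V),\qquad Q_n(f^*)=Q_n(f)\quad\text{for all }n\text{ and }f\in M_n((\tilde{\mathcal V})^*),$$ if and only if $\mathcal D$ is convex, midpoint balanced and midpoint concave. There is at most one matrix norm $\mathcal Q$ with these two properties. -/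

import Mathlib

open scoped Matrix Matrix.Norms.L2Operator ComplexConjugate ComplexOrder

noncomputable section

/-! ### Matrices over a complex vector space

`M_{m,n}(V)` is `Matrix (Fin m) (Fin n) V`.  The norm of a scalar matrix is its operator norm between
Euclidean spaces (`Matrix.Norms.L2Operator`). -/

/-- The matrix product `α v β = [∑ₖₗ αᵢₖ vₖₗ βₗⱼ]` of a matrix `v` over `V` with scalar matrices. -/
def matProd {V : Type*} [AddCommGroup V] [Module ℂ V] {m p q n : ℕ}
    (α : Matrix (Fin m) (Fin p) ℂ) (v : Matrix (Fin p) (Fin q) V) (β : Matrix (Fin q) (Fin n) ℂ) :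
    Matrix (Fin m) (Fin n) V :=
  Matrix.of fun i j => ∑ k, ∑ l, (α i k * β l j) • v k l

/-- The `2 × 2` block matrix with square blocks `a : m × m`, `b : m × n`, `c : n × m`, `d : n × n`. -/
def blockMat {V : Type*} {m n : ℕ} (a : Matrix (Fin m) (Fin m) V) (b : Matrix (Fin m) (Fin n) V)
    (c : Matrix (Fin n) (Fin m) V) (d : Matrix (Fin n) (Fin n) V) :
    Matrix (Fin (m + n)) (Fin (m + n)) V :=
  Matrix.reindex finSumFinEquiv finSumFinEquiv (Matrix.fromBlocks a b c d)

/-- The direct sum `v ⊕ w`. -/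
def dirSum {V : Type*} [Zero V] {m n : ℕ} (v : Matrix (Fin m) (Fin m) V)
    (w : Matrix (Fin n) (Fin n) V) : Matrix (Fin (m + n)) (Fin (m + n)) V :=
  blockMat v 0 0 w

/-- An element of `V` as a `1 × 1` matrix. -/
def oneByOne {V : Type*} (v : V) : Matrix (Fin 1) (Fin 1) V := Matrix.of fun _ _ => v

lemma blockMat_one {V : Type*} (a b c d : V) : blockMat (oneByOne a) (oneByOne b) (oneByOne c) (oneByOne d) =
    (!![a, b; c, d] : Matrix (Fin 2) (Fin 2) V) := by
  ext i j
  fin_cases i <;> fin_cases j <;> rfl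

/-! ### Matrix order unit spaces -/

/-- A matrix ordered space: a `*`-vector space `V` (the classes `StarAddMonoid V`, `StarModule ℂ V`)
such that each `M_n(V)` is partially ordered by a cone `M_n(V)⁺` of self-adjoint elements,
and `γ* M_n(V)⁺ γ ⊆ M_m(V)⁺` for all scalar `n × m` matrices `γ`. -/
class MatrixOrderedSpace (V : Type*) [AddCommGroup V] [Module ℂ V] [StarAddMonoid V]
    [StarModule ℂ V] where
  cone : ∀ n : ℕ, Set (Matrix (Fin n) (Fin n) V)
  isSelfAdjoint_of_mem : ∀ {n : ℕ} {v : Matrix (Fin n) (Fin n) V}, v ∈ cone n → vᴴ = v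
  zero_mem : ∀ n : ℕ, 0 ∈ cone n
  add_mem : ∀ {n : ℕ} {v w : Matrix (Fin n) (Fin n) V}, v ∈ cone n → w ∈ cone n → v + w ∈ cone n
  smul_mem : ∀ {n : ℕ} {t : ℝ} {v : Matrix (Fin n) (Fin n) V},
    0 ≤ t → v ∈ cone n → (t : ℂ) • v ∈ cone n
  eq_zero_of_mem_of_neg_mem : ∀ {n : ℕ} {v : Matrix (Fin n) (Fin n) V},
    v ∈ cone n → -v ∈ cone n → v = 0
  conj_mem : ∀ {n m : ℕ} (γ : Matrix (Fin n) (Fin m) ℂ) {v : Matrix (Fin n) (Fin n) V},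
    v ∈ cone n → matProd γᴴ v γ ∈ cone m

/-- A matrix order unit space `(V, 1)`; the distinguished order unit is `unit`. -/
class MatrixOrderUnitSpace (V : Type*) [AddCommGroup V] [Module ℂ V] [StarAddMonoid V]
    [StarModule ℂ V] extends MatrixOrderedSpace V where
  unit : V
  star_unit : star unit = unit
  exists_le_unit : ∀ v : V, star v = v →
    ∃ t : ℝ, 0 < t ∧ oneByOne ((t : ℂ) • unit - v) ∈ cone 1
  archimedean : ∀ {n : ℕ} {v : Matrix (Fin n) (Fin n) V},
    (∀ t : ℝ, 0 < t → (t : ℂ) • Matrix.diagonal (fun _ => unit) + v ∈ cone n) → v ∈ cone n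

section MatrixOrderUnit

variable (V : Type*) [AddCommGroup V] [Module ℂ V] [StarAddMonoid V] [StarModule ℂ V]
  [MatrixOrderUnitSpace V]

/-- The matrix `1_n ⊗ 1 ∈ M_n(V)`. -/
def unitMat (n : ℕ) : Matrix (Fin n) (Fin n) V :=
  Matrix.diagonal fun _ => MatrixOrderUnitSpace.unit

variable {V}

/-- The norm on `M_n(V)` determined by the matrix order:
`‖v‖ = inf {t : [[t1, v], [v*, t1]] ≥ 0}`.  (The condition `0 ≤ t` is automatic if `V ≠ 0`.) -/
def orderNorm {n : ℕ} (v : Matrix (Fin n) (Fin n) V) : ℝ :=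
  sInf {t : ℝ | 0 ≤ t ∧ blockMat ((t : ℂ) • unitMat V n) v vᴴ ((t : ℂ) • unitMat V n) ∈
    MatrixOrderedSpace.cone (V := V) (n + n)}

/-! Helper facts: `orderNorm` is a `*`-invariant seminorm at level one. -/

/-- `[[t1, v], [v*, t1]] ≥ 0`. -/
def NormLE (v : V) (t : ℝ) : Prop :=
  (!![(t : ℂ) • MatrixOrderUnitSpace.unit, v; star v, (t : ℂ) • MatrixOrderUnitSpace.unit] :
    Matrix (Fin 2) (Fin 2) V) ∈ MatrixOrderedSpace.cone (V := V) 2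

lemma orderNorm_oneByOne (v : V) : orderNorm (oneByOne v) = sInf {t : ℝ | 0 ≤ t ∧ NormLE v t} := by
  unfold orderNorm NormLE
  refine congrArg sInf (Set.ext fun t => ?_)
  have h1 : (t : ℂ) • unitMat V 1 = oneByOne ((t : ℂ) • MatrixOrderUnitSpace.unit) := by
    ext i j; fin_cases i; fin_cases j; simp [unitMat, oneByOne]
  have h2 : (oneByOne v)ᴴ = oneByOne (star v) := by
    ext i j; simp [oneByOne]
  rw [Set.mem_ofPred_eq, h1, h2, blockMat_one]
  rfl

lemma NormLE.add {v w : V} {s t : ℝ} (h : NormLE v s) (k : NormLE w t) :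
    NormLE (v + w) (s + t) := by
  have := MatrixOrderedSpace.add_mem h k
  unfold NormLE
  convert this using 1
  ext i j
  fin_cases i <;> fin_cases j <;> simp [add_smul]

lemma NormLE.smul {v : V} {t : ℝ} (h : NormLE v t) (c : ℂ) : NormLE (c • v) (‖c‖ * t) := by
  obtain ⟨u, hu, hc⟩ : ∃ u : ℂ, u * conj u = 1 ∧ c = ‖c‖ * u := by
    by_cases h0 : c = 0
    · exact ⟨1, by simp, by simp [h0]⟩
    · have hn : (‖c‖ : ℂ) ≠ 0 := by simpa using h0
      refine ⟨c / ‖c‖, ?_, by field_simp⟩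
      rw [map_div₀, Complex.conj_ofReal, div_mul_div_comm, Complex.mul_conj, Complex.normSq_eq_norm_sq]
      push_cast
      field_simp
  have h1 := MatrixOrderedSpace.smul_mem (norm_nonneg c)
    (MatrixOrderedSpace.conj_mem (!![1, 0; 0, u] : Matrix (Fin 2) (Fin 2) ℂ) h)
  unfold NormLE
  convert h1 using 1
  ext i j
  have hu' : conj u * u = 1 := by rw [mul_comm]; exact hu
  have hsc : star c = (‖c‖ : ℂ) * conj u := by
    conv_lhs => rw [hc]
    simp
  have hsc' : conj c = (‖c‖ : ℂ) * conj u := hsc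
  fin_cases i <;> fin_cases j <;>
    simp [-Complex.coe_smul, matProd, Fin.sum_univ_two, smul_smul]
  · rw [← hc]
  · rw [hsc']
  · rw [mul_assoc, ← mul_assoc (conj u), hu', one_mul]

lemma NormLE.star {v : V} {t : ℝ} (h : NormLE v t) : NormLE (star v) t := by
  have h1 := MatrixOrderedSpace.conj_mem (!![0, 1; 1, 0] : Matrix (Fin 2) (Fin 2) ℂ) h
  unfold NormLE
  convert h1 using 1
  ext i j
  fin_cases i <;> fin_cases j <;> simp [matProd, Fin.sum_univ_two]

lemma normLE_of_le {v : V} (hv : star v = v) {t : ℝ}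
    (h1 : oneByOne ((t : ℂ) • MatrixOrderUnitSpace.unit - v) ∈ MatrixOrderedSpace.cone 1)
    (h2 : oneByOne ((t : ℂ) • MatrixOrderUnitSpace.unit + v) ∈ MatrixOrderedSpace.cone 1) :
    NormLE v t := by
  have h3 := MatrixOrderedSpace.smul_mem (t := 1 / 2) (by norm_num) (MatrixOrderedSpace.add_mem
    (MatrixOrderedSpace.conj_mem (!![1, -1] : Matrix (Fin 1) (Fin 2) ℂ) h1)
    (MatrixOrderedSpace.conj_mem (!![1, 1] : Matrix (Fin 1) (Fin 2) ℂ) h2))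
  unfold NormLE
  rw [hv]
  convert h3 using 1
  ext i j
  fin_cases i <;> fin_cases j <;> simp [matProd, oneByOne] <;> module

lemma exists_normLE_of_sa {v : V} (hv : star v = v) : ∃ t : ℝ, 0 ≤ t ∧ NormLE v t := by
  obtain ⟨s, hs, h1⟩ := MatrixOrderUnitSpace.exists_le_unit v hv
  obtain ⟨t, ht, h2⟩ := MatrixOrderUnitSpace.exists_le_unit (-v) (by rw [star_neg, hv])
  obtain ⟨r, hr, h3⟩ := MatrixOrderUnitSpace.exists_le_unit (0 : V) (star_zero V)
  have hpos : ∀ c : ℝ, 0 ≤ c →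
      oneByOne ((c : ℂ) • (MatrixOrderUnitSpace.unit : V)) ∈ MatrixOrderedSpace.cone 1 := by
    intro c hc
    have := MatrixOrderedSpace.smul_mem (t := c / r) (by positivity) h3
    convert this using 1
    ext i j
    have hr' : (r : ℂ) ≠ 0 := by exact_mod_cast hr.ne'
    simp [-Complex.coe_smul, oneByOne, smul_smul, div_mul_cancel₀ _ hr']
  refine ⟨s + t, by positivity, normLE_of_le hv ?_ ?_⟩
  · convert MatrixOrderedSpace.add_mem h1 (hpos t ht.le) using 1
    ext i j
    simp [oneByOne]
    module
  · convert MatrixOrderedSpace.add_mem h2 (hpos s hs.le) using 1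
    ext i j
    simp [oneByOne]
    module

lemma exists_normLE (v : V) : ∃ t : ℝ, 0 ≤ t ∧ NormLE v t := by
  obtain ⟨s, hs, h1⟩ := exists_normLE_of_sa (v := (1 / 2 : ℂ) • (v + star v))
    (by simp [star_smul, add_comm])
  obtain ⟨t, ht, h2⟩ := exists_normLE_of_sa (v := (Complex.I / 2 : ℂ) • (star v - v))
    (by simp only [star_smul, star_sub, star_star, Complex.star_def, map_div₀, Complex.conj_I,
          Complex.conj_ofNat]
        module)
  have h3 := h1.add (h2.smul Complex.I)
  refine ⟨s + ‖Complex.I‖ * t, by positivity, ?_⟩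
  convert h3 using 1
  rw [smul_smul, ← mul_div_assoc, Complex.I_mul_I]
  module

lemma orderNorm_add_le (v w : V) :
    orderNorm (oneByOne (v + w)) ≤ orderNorm (oneByOne v) + orderNorm (oneByOne w) := by
  simp only [orderNorm_oneByOne]
  have hb : ∀ v : V, BddBelow {t : ℝ | 0 ≤ t ∧ NormLE v t} := fun v => ⟨0, fun t ht => ht.1⟩
  refine le_of_forall_pos_le_add fun ε hε => ?_
  obtain ⟨s, hs, hs'⟩ := exists_lt_of_csInf_lt (s := {t : ℝ | 0 ≤ t ∧ NormLE v t})
    (exists_normLE v) (lt_add_of_pos_right _ (half_pos hε))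
  obtain ⟨t, ht, ht'⟩ := exists_lt_of_csInf_lt (s := {t : ℝ | 0 ≤ t ∧ NormLE w t})
    (exists_normLE w) (lt_add_of_pos_right _ (half_pos hε))
  have := csInf_le (hb (v + w)) ⟨add_nonneg hs.1 ht.1, hs.2.add ht.2⟩
  linarith

lemma orderNorm_smul_le (c : ℂ) (v : V) :
    orderNorm (oneByOne (c • v)) ≤ ‖c‖ * orderNorm (oneByOne v) := by
  simp only [orderNorm_oneByOne]
  have hb : ∀ v : V, BddBelow {t : ℝ | 0 ≤ t ∧ NormLE v t} := fun v => ⟨0, fun t ht => ht.1⟩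
  refine le_of_forall_pos_le_add fun ε hε => ?_
  have hd : 0 < ε / (‖c‖ + 1) := by positivity
  obtain ⟨s, hs, hs'⟩ := exists_lt_of_csInf_lt (s := {t : ℝ | 0 ≤ t ∧ NormLE v t})
    (exists_normLE v) (lt_add_of_pos_right _ hd)
  have h1 := csInf_le (hb (c • v)) ⟨mul_nonneg (norm_nonneg c) hs.1, hs.2.smul c⟩
  have h2 := mul_le_mul_of_nonneg_left hs'.le (norm_nonneg c)
  have h3 : ‖c‖ * (ε / (‖c‖ + 1)) ≤ ε := by
    rw [mul_div_assoc', div_le_iff₀ (by positivity)]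
    nlinarith [norm_nonneg c]
  linarith

lemma orderNorm_star (v : V) : orderNorm (oneByOne (star v)) = orderNorm (oneByOne v) := by
  simp only [orderNorm_oneByOne]
  congr 1
  ext t
  exact ⟨fun h => ⟨h.1, by simpa using h.2.star⟩, fun h => ⟨h.1, h.2.star⟩⟩

lemma orderNorm_zero : orderNorm (oneByOne (0 : V)) = 0 := by
  have h := orderNorm_smul_le (0 : ℂ) (0 : V)
  rw [norm_zero, zero_mul, zero_smul] at h
  refine le_antisymm h ?_
  rw [orderNorm_oneByOne]
  exact Real.sInf_nonneg fun t ht => ht.1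

variable (V) in
/-- The norm of `V = M_1(V)`, as a seminorm. -/
def orderSeminorm : Seminorm ℂ V :=
  Seminorm.ofSMulLE (fun v => orderNorm (oneByOne v)) orderNorm_zero orderNorm_add_le
    orderNorm_smul_le

/-- `V` as a normed space, with the norm determined by the matrix order. -/
instance instSeminormedOrder : SeminormedAddCommGroup V :=
  (orderSeminorm V).toAddGroupSeminorm.toSeminormedAddCommGroup

lemma norm_eq_orderNorm (v : V) : ‖v‖ = orderNorm (oneByOne v) := rfl

instance instNormedSpaceOrder : NormedSpace ℂ V where
  norm_smul_le := orderNorm_smul_le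

instance instNormedStarGroupOrder : NormedStarGroup V where
  norm_star_le v := (orderNorm_star v).le

/-! ### The matrix state space -/

/-- The matrix `φ_r(a) ∈ M_r(M_n)` for `a ∈ M_r(V)`, where `φ ∈ M_n(V*)` is regarded as the
linear map `V → M_n`, `v ↦ [φᵢⱼ(v)]`. -/
def amplify {n r : ℕ} (φ : Matrix (Fin n) (Fin n) (StrongDual ℂ V))
    (a : Matrix (Fin r) (Fin r) V) : Matrix (Fin r × Fin n) (Fin r × Fin n) ℂ :=
  Matrix.of fun p q => φ p.2 q.2 (a p.1 q.1)

/-- `φ : V → M_n` is completely bounded. -/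
def IsCompletelyBounded {n : ℕ} (φ : Matrix (Fin n) (Fin n) (StrongDual ℂ V)) : Prop :=
  ∃ C : ℝ, ∀ (r : ℕ) (a : Matrix (Fin r) (Fin r) V), ‖amplify φ a‖ ≤ C * orderNorm a

/-- `φ : V → M_n` is completely positive. -/
def IsCompletelyPositive {n : ℕ} (φ : Matrix (Fin n) (Fin n) (StrongDual ℂ V)) : Prop :=
  ∀ (r : ℕ) (a : Matrix (Fin r) (Fin r) V),
    a ∈ MatrixOrderedSpace.cone (V := V) r → (amplify φ a).PosSemidef

variable (V) in
/-- The matrix states `CS_n(V)`: the completely bounded, completely positive maps `φ : V → M_n`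
with `φ(1) = 1_n`. -/
def matrixStates (n : ℕ) : Set (Matrix (Fin n) (Fin n) (StrongDual ℂ V)) :=
  {φ | IsCompletelyBounded φ ∧ IsCompletelyPositive φ ∧
    (Matrix.of fun i j => φ i j MatrixOrderUnitSpace.unit) = (1 : Matrix (Fin n) (Fin n) ℂ)}

/-! ### The quotient by the scalars and its dual -/

variable (V) in
/-- The subspace `ℂ1`. -/
def scalars : Submodule ℂ V := Submodule.span ℂ {MatrixOrderUnitSpace.unit}

variable (V) in
/-- The quotient `V/ℂ1`, with the quotient norm; its normed dual is `StrongDual ℂ (ModScalars V)`. -/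
abbrev ModScalars : Type _ := V ⧸ scalars V

/-- The involution of `V/ℂ1` induced by that of `V`. -/
def quotStar : ModScalars V →ₗ⋆[ℂ] ModScalars V :=
  Submodule.mapQ (scalars V) (scalars V) (starLinearEquiv ℂ (A := V)).toLinearMap (by
    rw [scalars, Submodule.span_singleton_le_iff_mem]
    simp [MatrixOrderUnitSpace.star_unit, Submodule.mem_span_singleton_self])

lemma quotStar_mk (v : V) :
    quotStar (Submodule.Quotient.mk v : ModScalars V) = Submodule.Quotient.mk (star v) := rfl

lemma continuous_quotStar : Continuous (quotStar : ModScalars V → ModScalars V) := by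
  rw [(scalars V).isQuotientMap_mkQ.continuous_iff]
  exact (scalars V).isQuotientMap_mkQ.continuous.comp (continuous_star (R := V))

/-- The adjoint `f* (x) = conj (f (x*))` of a functional on `V/ℂ1`. -/
def dualStar (f : StrongDual ℂ (ModScalars V)) : StrongDual ℂ (ModScalars V) where
  toFun x := conj (f (quotStar x))
  map_add' x y := by simp
  map_smul' c x := by simp
  cont := Complex.continuous_conj.comp (f.continuous.comp continuous_quotStar)

/-- The adjoint of `f ∈ M_n((V/ℂ1)*)`, i.e. `f*(x) = f(x*)*` when `f` is regarded as a map
`V/ℂ1 → M_n`. -/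
def matDualStar {n : ℕ} (f : Matrix (Fin n) (Fin n) (StrongDual ℂ (ModScalars V))) :
    Matrix (Fin n) (Fin n) (StrongDual ℂ (ModScalars V)) :=
  Matrix.of fun i j => dualStar (f j i)

/-- For matrix states `φ, ψ`, the difference `φ - ψ` vanishes at `1`; this is `φ - ψ` as an
element of `M_n((V/ℂ1)*)`. -/
def stateDiff {n : ℕ} (φ ψ : matrixStates V n) :
    Matrix (Fin n) (Fin n) (StrongDual ℂ (ModScalars V)) :=
  Matrix.of fun i j => (scalars V).liftQL (φ.1 i j - ψ.1 i j) (by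
    rw [scalars, Submodule.span_singleton_le_iff_mem]
    have h := congrFun (congrFun (φ.2.2.2.trans ψ.2.2.2.symm) i) j
    simpa [sub_eq_zero] using h)

lemma stateDiff_apply {n : ℕ} (φ ψ : matrixStates V n) (i j : Fin n) (v : V) :
    stateDiff φ ψ i j (Submodule.Quotient.mk v) = φ.1 i j v - ψ.1 i j v := rfl

end MatrixOrderUnit

/-! ### Matrix norms and matrix metrics -/

/-- `Q = (Q_n)` is a matrix norm on the vector space `W`. -/
structure IsMatrixNorm {W : Type*} [AddCommGroup W] [Module ℂ W]
    (Q : ∀ n : ℕ, Matrix (Fin n) (Fin n) W → ℝ) : Prop where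
  nonneg : ∀ (n : ℕ) (v : Matrix (Fin n) (Fin n) W), 0 ≤ Q n v
  add_le : ∀ (n : ℕ) (v w : Matrix (Fin n) (Fin n) W), Q n (v + w) ≤ Q n v + Q n w
  smul_le : ∀ (n : ℕ) (c : ℂ) (v : Matrix (Fin n) (Fin n) W), Q n (c • v) ≤ ‖c‖ * Q n v
  eq_zero : ∀ (n : ℕ) (v : Matrix (Fin n) (Fin n) W), Q n v = 0 → v = 0
  dirSum_eq : ∀ (m n : ℕ) (v : Matrix (Fin m) (Fin m) W) (w : Matrix (Fin n) (Fin n) W),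
    Q (m + n) (dirSum v w) = max (Q m v) (Q n w)
  matProd_le : ∀ (m n : ℕ) (α : Matrix (Fin n) (Fin m) ℂ) (v : Matrix (Fin m) (Fin m) W)
    (β : Matrix (Fin m) (Fin n) ℂ), Q n (matProd α v β) ≤ ‖α‖ * Q m v * ‖β‖

/-- `ρ` is a (finite) metric on `X`. -/
structure IsMetric {X : Type*} (ρ : X → X → ℝ) : Prop where
  nonneg : ∀ x y, 0 ≤ ρ x y
  eq_zero_iff : ∀ x y, ρ x y = 0 ↔ x = y
  symm : ∀ x y, ρ x y = ρ y x
  triangle : ∀ x y z, ρ x z ≤ ρ x y + ρ y z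

/-- `D = (D_n)` is a matrix metric on the graded set `K = (K_n)`, `K_n ⊆ M_n(W)`. -/
structure IsMatrixMetric {W : Type*} [AddCommGroup W] [Module ℂ W]
    {K : ∀ n : ℕ, Set (Matrix (Fin n) (Fin n) W)} (D : ∀ n : ℕ, K n → K n → ℝ) : Prop where
  isMetric : ∀ n : ℕ, IsMetric (D n)
  dirSum_eq : ∀ (m n : ℕ) (x u : K m) (y v : K n) (p q : K (m + n)),
    p.1 = dirSum x.1 y.1 → q.1 = dirSum u.1 v.1 → D (m + n) p q = max (D m x u) (D n y v)
  compress_le : ∀ (m n : ℕ) (x u : K m) (α : Matrix (Fin m) (Fin n) ℂ) (p q : K n),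
    αᴴ * α = 1 → p.1 = matProd αᴴ x.1 α → q.1 = matProd αᴴ u.1 α → D n p q ≤ D m x u

/-- The metric `ρ` on the convex set `K` is convex. -/
def IsConvexMetric {E : Type*} [AddCommGroup E] [Module ℂ E] {K : Set E} (ρ : K → K → ℝ) : Prop :=
  ∀ (x y z w : K) (t : ℝ), 0 ≤ t → t ≤ 1 →
    (w : E) = (t : ℂ) • (y : E) + ((1 - t : ℝ) : ℂ) • (z : E) →
    ρ x w ≤ t * ρ x y + (1 - t) * ρ x z

/-- The metric `ρ` on the convex set `K` is midpoint balanced. -/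
def IsMidpointBalanced {E : Type*} [AddCommGroup E] [Module ℂ E] {K : Set E} (ρ : K → K → ℝ) :
    Prop :=
  ∀ x y u v : K, (1 / 2 : ℂ) • ((x : E) + v) = (1 / 2 : ℂ) • ((y : E) + u) → ρ x u = ρ y v

/-- The metric `ρ` on the convex set `K` is midpoint concave. -/
def IsMidpointConcave {E : Type*} [AddCommGroup E] [Module ℂ E] {K : Set E} (ρ : K → K → ℝ) :
    Prop :=
  ∀ x y u v p q : K, (p : E) = (1 / 2 : ℂ) • ((x : E) + u) → (q : E) = (1 / 2 : ℂ) • ((y : E) + v) →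
    ρ p q ≤ 1 / 2 * (ρ x y + ρ u v)

/-- `Q` is a matrix norm on `(V/ℂ1)*` with `Q_n(φ - ψ) = D_n(φ, ψ)` for all matrix states `φ, ψ`
and `Q_n(f*) = Q_n(f)` for all `f`. -/
structure IsNormInducing {V : Type*} [AddCommGroup V] [Module ℂ V] [StarAddMonoid V]
    [StarModule ℂ V] [MatrixOrderUnitSpace V]
    (D : ∀ n : ℕ, matrixStates V n → matrixStates V n → ℝ)
    (Q : ∀ n : ℕ, Matrix (Fin n) (Fin n) (StrongDual ℂ (ModScalars V)) → ℝ) : Prop where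
  isMatrixNorm : IsMatrixNorm Q
  stateDiff_eq : ∀ (n : ℕ) (φ ψ : matrixStates V n), Q n (stateDiff φ ψ) = D n φ ψ
  star_eq : ∀ (n : ℕ) (f : Matrix (Fin n) (Fin n) (StrongDual ℂ (ModScalars V))),
    Q n (matDualStar f) = Q n f

end

/-! If `V` has a state, the self-adjoint elements of `M_n((V/ℂ1)*)` are exactly the multiples `c(φ -
ψ)`, `c ≥ 0`, of differences of matrix states (`exists_eq_smul_sub`, `stateDiff_conjTranspose`). On
them the norm can only be `c(φ - ψ) ↦ c D(φ, ψ)`, and the three conditions make this formula a norm: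
midpoint balance says that `D(φ, ψ)` depends only on `φ - ψ`; convexity and the triangle inequality
give homogeneity for factors in `[0, 1]` (`IsNormLike.eq_mul_of_sub_eq`), hence independence of the
representation; midpoint concavity gives subadditivity. Conversely, distances measured by a norm
have the three properties (`IsMatrixNorm.isNormLike`).

An arbitrary `f` enters through the self-adjoint matrix `[[0, f], [f*, 0]]`. A `*`-invariant matrix
norm gives it the norm of `f`, since a swap of columns turns it into `f ⊕ f*`
(`IsMatrixNorm.hermBlock_eq`). This proves uniqueness and dictates the definition `inducedNorm`. If
`f = f*`, a Hadamard unitary turns the block into `f ⊕ (-f)`, so that the new norm extends the old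
one (`inducedNorm_of_selfadjoint`). The product `αfβ` corresponds to conjugating the block by
`diag(α*, β)`; for contractions this is part of an isometric compression of the block plus a zero
summand (`exists_dilation`, `IsNormLike.diffNorm_conj_le`), to which the compression axiom of a
matrix metric applies.

The analytic input is the Jordan decomposition of bounded self-adjoint functionals, a consequence of
the M. Riesz extension theorem (`exists_positive_sub_positive`). It passes to matrices entry by
entry, and a common completely positive summand then makes both parts multiples of unital maps.
Without states the dual of `V` is zero and everything is trivial. -/

set_option linter.unusedSectionVars false

/-! ### Entries of block matrices -/

section Blocks

variable {m n : ℕ}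

@[simp] lemma blockMat_castAdd_castAdd {X : Type*} (a : Matrix (Fin m) (Fin m) X)
    (b : Matrix (Fin m) (Fin n) X)
    (c : Matrix (Fin n) (Fin m) X) (d : Matrix (Fin n) (Fin n) X) (i j : Fin m) :
    blockMat a b c d (Fin.castAdd n i) (Fin.castAdd n j) = a i j := by
  simp [blockMat]

@[simp] lemma blockMat_castAdd_natAdd {X : Type*} (a : Matrix (Fin m) (Fin m) X)
    (b : Matrix (Fin m) (Fin n) X)
    (c : Matrix (Fin n) (Fin m) X) (d : Matrix (Fin n) (Fin n) X) (i : Fin m) (j : Fin n) :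
    blockMat a b c d (Fin.castAdd n i) (Fin.natAdd m j) = b i j := by
  simp [blockMat]

@[simp] lemma blockMat_natAdd_castAdd {X : Type*} (a : Matrix (Fin m) (Fin m) X)
    (b : Matrix (Fin m) (Fin n) X)
    (c : Matrix (Fin n) (Fin m) X) (d : Matrix (Fin n) (Fin n) X) (i : Fin n) (j : Fin m) :
    blockMat a b c d (Fin.natAdd m i) (Fin.castAdd n j) = c i j := by
  simp [blockMat]

@[simp] lemma blockMat_natAdd_natAdd {X : Type*} (a : Matrix (Fin m) (Fin m) X)
    (b : Matrix (Fin m) (Fin n) X)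
    (c : Matrix (Fin n) (Fin m) X) (d : Matrix (Fin n) (Fin n) X) (i j : Fin n) :
    blockMat a b c d (Fin.natAdd m i) (Fin.natAdd m j) = d i j := by
  simp [blockMat]

end Blocks

/-! ### Products with scalar matrices, block-diagonal matrices and the Hadamard unitary -/

section MatProd

variable {V : Type*} [AddCommGroup V] [Module ℂ V] {m n p q r s : ℕ}

lemma matProd_apply (α : Matrix (Fin m) (Fin p) ℂ) (v : Matrix (Fin p) (Fin q) V)
    (β : Matrix (Fin q) (Fin n) ℂ) (i : Fin m) (j : Fin n) :
    matProd α v β i j = ∑ k, ∑ l, (α i k * β l j) • v k l := rfl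

lemma matProd_sub (α : Matrix (Fin m) (Fin p) ℂ) (v w : Matrix (Fin p) (Fin q) V)
    (β : Matrix (Fin q) (Fin n) ℂ) : matProd α (v - w) β = matProd α v β - matProd α w β := by
  ext i j
  simp [matProd_apply, smul_sub]

lemma matProd_smul (α : Matrix (Fin m) (Fin p) ℂ) (c : ℂ) (v : Matrix (Fin p) (Fin q) V)
    (β : Matrix (Fin q) (Fin n) ℂ) : matProd α (c • v) β = c • matProd α v β := by
  ext i j
  simp [matProd_apply, Finset.smul_sum, smul_comm c]

lemma smul_matProd (α : Matrix (Fin m) (Fin p) ℂ) (c : ℂ) (v : Matrix (Fin p) (Fin q) V)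
    (β : Matrix (Fin q) (Fin n) ℂ) : matProd (c • α) v β = c • matProd α v β := by
  ext i j
  simp [matProd_apply, Finset.smul_sum, smul_smul, mul_assoc]

lemma matProd_smul_right (α : Matrix (Fin m) (Fin p) ℂ) (c : ℂ) (v : Matrix (Fin p) (Fin q) V)
    (β : Matrix (Fin q) (Fin n) ℂ) : matProd α v (c • β) = c • matProd α v β := by
  ext i j
  simp [matProd_apply, Finset.smul_sum, smul_smul, mul_left_comm]

lemma matProd_one (v : Matrix (Fin p) (Fin q) V) : matProd 1 v 1 = v := by
  ext i j
  simp [matProd_apply, Matrix.one_apply, ite_smul]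

/-- Permuting indices is a product with scalar matrices, so the axioms for products and compressions
apply to it. -/
lemma matProd_submatrix (v : Matrix (Fin p) (Fin q) V) (e : Fin m → Fin p) (f : Fin n → Fin q) :
    matProd ((1 : Matrix (Fin p) (Fin p) ℂ).submatrix e id) v
      ((1 : Matrix (Fin q) (Fin q) ℂ).submatrix id f) = v.submatrix e f := by
  ext i j
  simp [matProd_apply, Matrix.one_apply, ite_smul]

lemma ext_blocks {X : Type*} {v w : Matrix (Fin (m + n)) (Fin (p + q)) X}
    (h11 : ∀ i j, v (Fin.castAdd n i) (Fin.castAdd q j) = w (Fin.castAdd n i) (Fin.castAdd q j))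
    (h12 : ∀ i j, v (Fin.castAdd n i) (Fin.natAdd p j) = w (Fin.castAdd n i) (Fin.natAdd p j))
    (h21 : ∀ i j, v (Fin.natAdd m i) (Fin.castAdd q j) = w (Fin.natAdd m i) (Fin.castAdd q j))
    (h22 : ∀ i j, v (Fin.natAdd m i) (Fin.natAdd p j) = w (Fin.natAdd m i) (Fin.natAdd p j)) :
    v = w := by
  ext i j
  refine Fin.addCases (fun i => ?_) (fun i => ?_) i <;>
    refine Fin.addCases (fun j => ?_) (fun j => ?_) j
  exacts [h11 i j, h12 i j, h21 i j, h22 i j]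

/-- The rectangular block-diagonal scalar matrix with blocks `α` and `β`. -/
def diagBlock (α : Matrix (Fin m) (Fin p) ℂ) (β : Matrix (Fin n) (Fin q) ℂ) :
    Matrix (Fin (m + n)) (Fin (p + q)) ℂ :=
  Matrix.reindex finSumFinEquiv finSumFinEquiv (Matrix.fromBlocks α 0 0 β)

@[simp] lemma diagBlock_castAdd_castAdd (α : Matrix (Fin m) (Fin p) ℂ)
    (β : Matrix (Fin n) (Fin q) ℂ) (i : Fin m) (j : Fin p) :
    diagBlock α β (Fin.castAdd n i) (Fin.castAdd q j) = α i j := by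
  simp [diagBlock]

@[simp] lemma diagBlock_castAdd_natAdd (α : Matrix (Fin m) (Fin p) ℂ)
    (β : Matrix (Fin n) (Fin q) ℂ) (i : Fin m) (j : Fin q) :
    diagBlock α β (Fin.castAdd n i) (Fin.natAdd p j) = 0 := by
  simp [diagBlock]

@[simp] lemma diagBlock_natAdd_castAdd (α : Matrix (Fin m) (Fin p) ℂ)
    (β : Matrix (Fin n) (Fin q) ℂ) (i : Fin n) (j : Fin p) :
    diagBlock α β (Fin.natAdd m i) (Fin.castAdd q j) = 0 := by
  simp [diagBlock]

@[simp] lemma diagBlock_natAdd_natAdd (α : Matrix (Fin m) (Fin p) ℂ)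
    (β : Matrix (Fin n) (Fin q) ℂ) (i : Fin n) (j : Fin q) :
    diagBlock α β (Fin.natAdd m i) (Fin.natAdd p j) = β i j := by
  simp [diagBlock]

lemma matProd_diagBlock (α : Matrix (Fin p) (Fin m) ℂ) (α' : Matrix (Fin q) (Fin n) ℂ)
    (a : Matrix (Fin m) (Fin m) V) (b : Matrix (Fin m) (Fin n) V)
    (c : Matrix (Fin n) (Fin m) V) (d : Matrix (Fin n) (Fin n) V)
    (β : Matrix (Fin m) (Fin p) ℂ) (β' : Matrix (Fin n) (Fin q) ℂ) :
    matProd (diagBlock α α') (blockMat a b c d) (diagBlock β β') =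
      blockMat (matProd α a β) (matProd α b β') (matProd α' c β) (matProd α' d β') := by
  apply ext_blocks <;> intro i j <;> simp [matProd_apply, Fin.sum_univ_add]

lemma diagBlock_conjTranspose (α : Matrix (Fin m) (Fin p) ℂ) (β : Matrix (Fin n) (Fin q) ℂ) :
    (diagBlock α β)ᴴ = diagBlock αᴴ βᴴ := by
  apply ext_blocks <;> intro i j <;> simp [Matrix.conjTranspose_apply]

lemma diagBlock_mul (α : Matrix (Fin m) (Fin p) ℂ) (β : Matrix (Fin n) (Fin q) ℂ)
    (γ : Matrix (Fin p) (Fin r) ℂ) (δ : Matrix (Fin q) (Fin s) ℂ) :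
    diagBlock α β * diagBlock γ δ = diagBlock (α * γ) (β * δ) := by
  apply ext_blocks <;> intro i j <;> simp [Matrix.mul_apply, Fin.sum_univ_add]

lemma diagBlock_add (α γ : Matrix (Fin m) (Fin p) ℂ) (β δ : Matrix (Fin n) (Fin q) ℂ) :
    diagBlock α β + diagBlock γ δ = diagBlock (α + γ) (β + δ) := by
  apply ext_blocks <;> intro i j <;> simp

lemma diagBlock_one : diagBlock (1 : Matrix (Fin m) (Fin m) ℂ) (1 : Matrix (Fin n) (Fin n) ℂ) =
    1 := by
  simp [diagBlock]

/-- Stacking a matrix on top of another one. -/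
def colBlock (α : Matrix (Fin m) (Fin p) ℂ) (β : Matrix (Fin n) (Fin p) ℂ) :
    Matrix (Fin (m + n)) (Fin p) ℂ :=
  Matrix.of (Fin.append α β)

@[simp] lemma colBlock_castAdd (α : Matrix (Fin m) (Fin p) ℂ) (β : Matrix (Fin n) (Fin p) ℂ)
    (i : Fin m) (j : Fin p) : colBlock α β (Fin.castAdd n i) j = α i j :=
  congrFun (Fin.append_left α β i) j

@[simp] lemma colBlock_natAdd (α : Matrix (Fin m) (Fin p) ℂ) (β : Matrix (Fin n) (Fin p) ℂ)
    (i : Fin n) (j : Fin p) : colBlock α β (Fin.natAdd m i) j = β i j :=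
  congrFun (Fin.append_right α β i) j

lemma colBlock_conjTranspose_mul_self (α : Matrix (Fin m) (Fin p) ℂ)
    (β : Matrix (Fin n) (Fin p) ℂ) : (colBlock α β)ᴴ * colBlock α β = αᴴ * α + βᴴ * β := by
  ext i j
  simp [Matrix.mul_apply, Fin.sum_univ_add]

lemma matProd_colBlock_dirSum (α : Matrix (Fin m) (Fin p) ℂ) (β : Matrix (Fin n) (Fin p) ℂ)
    (v : Matrix (Fin m) (Fin m) V) (w : Matrix (Fin n) (Fin n) V) :
    matProd (colBlock α β)ᴴ (dirSum v w) (colBlock α β) = matProd αᴴ v α + matProd βᴴ w β := by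
  ext i j
  simp [matProd_apply, Fin.sum_univ_add, dirSum]

lemma dirSum_eq_add (v : Matrix (Fin m) (Fin m) V) (w : Matrix (Fin n) (Fin n) V) :
    dirSum v w = matProd (colBlock (1 : Matrix (Fin m) (Fin m) ℂ) 0) v
        (colBlock (1 : Matrix (Fin m) (Fin m) ℂ) (0 : Matrix (Fin n) (Fin m) ℂ))ᴴ +
      matProd (colBlock 0 (1 : Matrix (Fin n) (Fin n) ℂ)) w
        (colBlock (0 : Matrix (Fin m) (Fin n) ℂ) (1 : Matrix (Fin n) (Fin n) ℂ))ᴴ := by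
  apply ext_blocks <;> intro i j <;>
    simp [dirSum, matProd_apply, Matrix.conjTranspose_apply, Matrix.one_apply, ite_smul]

lemma dirSum_sub (v v' : Matrix (Fin m) (Fin m) V) (w w' : Matrix (Fin n) (Fin n) V) :
    dirSum (v - v') (w - w') = dirSum v w - dirSum v' w' := by
  apply ext_blocks <;> intro i j <;> simp [dirSum]

lemma dirSum_smul (c : ℂ) (v : Matrix (Fin m) (Fin m) V) (w : Matrix (Fin n) (Fin n) V) :
    dirSum (c • v) (c • w) = c • dirSum v w := by
  apply ext_blocks <;> intro i j <;> simp [dirSum]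

/-- The scaled Hadamard matrix `(1/√2) [[1, 1], [1, -1]]`. -/
noncomputable def hadamard (n : ℕ) : Matrix (Fin (n + n)) (Fin (n + n)) ℂ :=
  ((Real.sqrt (1 / 2) : ℝ) : ℂ) • blockMat 1 1 1 (-1)

lemma hadamard_conjTranspose (n : ℕ) : (hadamard n)ᴴ = hadamard n := by
  apply ext_blocks <;> intro i j <;>
    simp [-Fin.natAdd_eq_addNat, hadamard, Matrix.conjTranspose_apply, Matrix.one_apply,
      eq_comm (a := i), apply_ite] <;> tauto

lemma sqrt_half_mul_self :
    ((Real.sqrt (1 / 2) : ℝ) : ℂ) * ((Real.sqrt (1 / 2) : ℝ) : ℂ) = 1 / 2 := by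
  rw [← Complex.ofReal_mul, Real.mul_self_sqrt (by norm_num)]
  norm_num

lemma hadamard_mul_self (n : ℕ) : hadamard n * hadamard n = 1 := by
  rw [hadamard, smul_mul_smul_comm, sqrt_half_mul_self]
  have h : ∀ i j : Fin n, Fin.castAdd n i ≠ Fin.natAdd n j := fun i j => by
    simp only [ne_eq, Fin.ext_iff, Fin.val_castAdd, Fin.val_natAdd]
    omega
  apply ext_blocks <;> intro i j <;>
    simp [-Fin.natAdd_eq_addNat, Matrix.mul_apply, Fin.sum_univ_add, Matrix.one_apply, h,
      (h _ _).symm] <;>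
    split_ifs <;> norm_num

/-- The Hadamard matrix diagonalises the flip of the two summands, with eigenvalues `1` and `-1`.
Being its own inverse, it also leads back. -/
lemma matProd_hadamard (v : Matrix (Fin n) (Fin n) V) :
    matProd (hadamard n)ᴴ (dirSum v (-v)) (hadamard n) = blockMat 0 v v 0 := by
  rw [hadamard_conjTranspose, hadamard, smul_matProd, matProd_smul_right, smul_smul,
    sqrt_half_mul_self]
  apply ext_blocks <;> intro i j <;>
    simp [-Fin.natAdd_eq_addNat, dirSum, matProd_apply, Fin.sum_univ_add, Matrix.one_apply,
      ite_smul] <;> module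

lemma matProd_hadamard_offDiag (v : Matrix (Fin n) (Fin n) V) :
    matProd (hadamard n)ᴴ (blockMat 0 v v 0) (hadamard n) = dirSum v (-v) := by
  rw [hadamard_conjTranspose, hadamard, smul_matProd, matProd_smul_right, smul_smul,
    sqrt_half_mul_self]
  apply ext_blocks <;> intro i j <;>
    simp [-Fin.natAdd_eq_addNat, dirSum, matProd_apply, Fin.sum_univ_add, Matrix.one_apply,
      ite_smul] <;> module

end MatProd

/-! ### Norm and positivity of scalar matrices -/

section ScalarMatrix

variable {n : Type*} [Fintype n] [DecidableEq n]

open scoped MatrixOrder in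
lemma posSemidef_smul_one_sub {A : Matrix n n ℂ} (hA : A.IsHermitian) {t : ℝ} (ht : ‖A‖ ≤ t) :
    ((t : ℂ) • (1 : Matrix n n ℂ) - A).PosSemidef := by
  have h : IsSelfAdjoint A := hA
  have h1 := h.le_algebraMap_norm_self
  rw [Matrix.le_iff] at h1
  have h2 : (((t - ‖A‖ : ℝ) : ℂ) • (1 : Matrix n n ℂ)).PosSemidef :=
    Matrix.PosSemidef.one.smul (by exact_mod_cast sub_nonneg.2 ht)
  have h3 : (t : ℂ) • (1 : Matrix n n ℂ) - A =
      algebraMap ℝ (Matrix n n ℂ) ‖A‖ - A + ((t - ‖A‖ : ℝ) : ℂ) • (1 : Matrix n n ℂ) := by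
    rw [Algebra.algebraMap_eq_smul_one, Complex.coe_smul, Complex.coe_smul, sub_smul]
    abel
  rw [h3]
  exact h1.add h2

lemma posSemidef_smul_one_add {A : Matrix n n ℂ} (hA : A.IsHermitian) {t : ℝ} (ht : ‖A‖ ≤ t) :
    ((t : ℂ) • (1 : Matrix n n ℂ) + A).PosSemidef := by
  simpa using posSemidef_smul_one_sub hA.neg (by rwa [norm_neg])

-- For a contraction, `1 - α*α` is positive semidefinite and so of the form `δ*δ`. The stack of `α`
-- on `δ` is then an isometry.
open scoped MatrixOrder in
lemma exists_dilation {m n : ℕ} (α : Matrix (Fin m) (Fin n) ℂ) (hα : ‖α‖ ≤ 1) :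
    ∃ δ : Matrix (Fin n) (Fin n) ℂ, αᴴ * α + δᴴ * δ = 1 := by
  have h1 : ‖αᴴ * α‖ ≤ 1 := by
    rw [Matrix.l2_opNorm_conjTranspose_mul_self]
    exact mul_le_one₀ hα (norm_nonneg _) hα
  have h2 := posSemidef_smul_one_sub (Matrix.isHermitian_conjTranspose_mul_self α) h1
  obtain ⟨δ, hδ⟩ := CStarAlgebra.nonneg_iff_eq_star_mul_self.1 h2.nonneg
  rw [Matrix.star_eq_conjTranspose] at hδ
  refine ⟨δ, ?_⟩
  rw [← hδ]
  simp

-- The Schur complement of the upper left corner gives `M*M ≤ s²` for every `s > t`.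
open scoped MatrixOrder in
lemma norm_le_of_posSemidef_fromBlocks {M : Matrix n n ℂ} {t : ℝ} (ht : 0 ≤ t)
    (h : (Matrix.fromBlocks ((t : ℂ) • 1) M Mᴴ ((t : ℂ) • 1)).PosSemidef) : ‖M‖ ≤ t := by
  refine le_of_forall_pos_le_add fun ε hε => ?_
  -- The corner has to be positive definite, also when `t = 0`.
  set s := t + ε with hs
  have hs0 : 0 < s := by positivity
  have hsC : (s : ℂ) ≠ 0 := by exact_mod_cast hs0.ne'
  have h0 : (((ε : ℝ) : ℂ) • (1 : Matrix (n ⊕ n) (n ⊕ n) ℂ)).PosSemidef :=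
    Matrix.PosSemidef.one.smul (by exact_mod_cast hε.le)
  have h1 : (Matrix.fromBlocks ((s : ℂ) • 1) M Mᴴ ((s : ℂ) • 1)).PosSemidef := by
    have h2 := h.add h0
    rwa [← Matrix.fromBlocks_one, Matrix.fromBlocks_smul, Matrix.fromBlocks_add, ← add_smul,
      ← Complex.ofReal_add, smul_zero, add_zero, add_zero] at h2
  have hA : ((s : ℂ) • (1 : Matrix n n ℂ)).PosDef :=
    Matrix.PosDef.one.smul (by exact_mod_cast hs0)
  have hinv : ((s : ℂ) • (1 : Matrix n n ℂ))⁻¹ = (s : ℂ)⁻¹ • 1 :=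
    Matrix.inv_eq_right_inv (by simp [-Complex.coe_smul, smul_smul, hsC])
  let _ : Invertible ((s : ℂ) • (1 : Matrix n n ℂ)) := hA.isUnit.invertible
  rw [Matrix.PosDef.fromBlocks₁₁ M _ hA, hinv] at h1
  have h2 : (algebraMap ℝ (Matrix n n ℂ) (s * s) - Mᴴ * M).PosSemidef := by
    have hs1 : (0 : ℂ) ≤ (s : ℂ) := by exact_mod_cast hs0.le
    have h3 := h1.smul hs1
    rwa [smul_sub, smul_smul, Matrix.mul_smul, Matrix.smul_mul, mul_one, smul_smul,
      mul_inv_cancel₀ hsC, one_smul, ← Complex.ofReal_mul, Complex.coe_smul,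
      ← Algebra.algebraMap_eq_smul_one] at h3
  have h3 := (CStarAlgebra.norm_le_iff_le_algebraMap (Mᴴ * M) (mul_self_nonneg s)
    (Matrix.posSemidef_conjTranspose_mul_self M).nonneg).2 (Matrix.le_iff.2 h2)
  rw [Matrix.l2_opNorm_conjTranspose_mul_self] at h3
  exact (mul_self_le_mul_self_iff (norm_nonneg M) hs0.le).2 h3

end ScalarMatrix

/-! ### Positive functionals and the Jordan decomposition -/

section Functionals

variable {V : Type*} [AddCommGroup V] [Module ℂ V] [StarAddMonoid V] [StarModule ℂ V]
  [MatrixOrderUnitSpace V]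

/-- Positivity of an element of a matrix order unit space. -/
def IsPos (v : V) : Prop := oneByOne v ∈ MatrixOrderedSpace.cone (V := V) 1

lemma isPos_zero : IsPos (0 : V) := by
  exact MatrixOrderedSpace.zero_mem (V := V) 1

lemma IsPos.add {v w : V} (hv : IsPos v) (hw : IsPos w) : IsPos (v + w) := by
  unfold IsPos
  exact MatrixOrderedSpace.add_mem hv hw

lemma IsPos.smul {v : V} (hv : IsPos v) {t : ℝ} (ht : 0 ≤ t) : IsPos ((t : ℂ) • v) := by
  unfold IsPos
  exact MatrixOrderedSpace.smul_mem ht hv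

lemma isPos_unit : IsPos (MatrixOrderUnitSpace.unit : V) := by
  obtain ⟨t, ht, h⟩ := MatrixOrderUnitSpace.exists_le_unit (0 : V) (star_zero V)
  have h1 := IsPos.smul h (inv_nonneg.2 ht.le)
  have ht' : (t : ℂ) ≠ 0 := by exact_mod_cast ht.ne'
  rwa [sub_zero, smul_smul, Complex.ofReal_inv, inv_mul_cancel₀ ht', one_smul] at h1

/-- The selfadjoint part `(v + v*) / 2` of `v`. -/
noncomputable def selfPart (v : V) : V := (1 / 2 : ℂ) • (v + star v)

lemma selfPart_apply (v : V) : selfPart v = (1 / 2 : ℂ) • (v + star v) := rfl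

lemma selfPart_add (v w : V) : selfPart (v + w) = selfPart v + selfPart w := by
  simp only [selfPart_apply, star_add]
  module

lemma selfPart_neg (v : V) : selfPart (-v) = -selfPart v := by
  simp only [selfPart_apply, star_neg]
  module

lemma selfPart_sub (v w : V) : selfPart (v - w) = selfPart v - selfPart w := by
  simp only [selfPart_apply, star_sub]
  module

lemma selfPart_smul (t : ℝ) (v : V) : selfPart (t • v) = (t : ℂ) • selfPart v := by
  simp only [selfPart_apply, ← Complex.coe_smul, star_smul, Complex.star_def, Complex.conj_ofReal]
  module

lemma selfPart_zero : selfPart (0 : V) = 0 := by simp [selfPart_apply]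

lemma star_selfPart (v : V) : star (selfPart v) = selfPart v := by
  simp [selfPart_apply, star_smul, add_comm]

lemma selfPart_of_star_eq {v : V} (hv : star v = v) : selfPart v = v := by
  rw [selfPart_apply, hv]
  module

lemma IsPos.star_eq {v : V} (hv : IsPos v) : star v = v :=
  congrFun (congrFun (MatrixOrderedSpace.isSelfAdjoint_of_mem hv) 0) 0

lemma NormLE.isPos_add {v : V} {t : ℝ} (h : NormLE v t) :
    IsPos ((t : ℂ) • MatrixOrderUnitSpace.unit + selfPart v) := by
  have h1 := MatrixOrderedSpace.smul_mem (t := 1 / 2) (by norm_num)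
    (MatrixOrderedSpace.conj_mem (!![1; 1] : Matrix (Fin 2) (Fin 1) ℂ) h)
  unfold IsPos
  convert h1 using 1
  ext i j
  fin_cases i
  fin_cases j
  simp [-Complex.coe_smul, oneByOne, matProd, Fin.sum_univ_two, selfPart_apply]
  module

lemma NormLE.isPos_sub {v : V} {t : ℝ} (h : NormLE v t) :
    IsPos ((t : ℂ) • MatrixOrderUnitSpace.unit - selfPart v) := by
  have h1 := h.smul (-1)
  simp only [neg_smul, one_smul, norm_neg, norm_one, one_mul] at h1
  simpa [sub_eq_add_neg, selfPart_neg] using h1.isPos_add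

lemma norm_le_of_normLE {v : V} {t : ℝ} (ht : 0 ≤ t) (h : NormLE v t) : ‖v‖ ≤ t := by
  rw [norm_eq_orderNorm, orderNorm_oneByOne]
  exact csInf_le ⟨0, fun t ht => ht.1⟩ ⟨ht, h⟩

lemma exists_normLE_lt (v : V) {ε : ℝ} (hε : 0 < ε) :
    ∃ t : ℝ, 0 ≤ t ∧ t < ‖v‖ + ε ∧ NormLE v t := by
  rw [norm_eq_orderNorm, orderNorm_oneByOne]
  obtain ⟨t, ht, ht'⟩ := exists_lt_of_csInf_lt (s := {t : ℝ | 0 ≤ t ∧ NormLE v t})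
    (exists_normLE v) (lt_add_of_pos_right _ hε)
  exact ⟨t, ht.1, ht', ht.2⟩

lemma le_mul_of_forall_pos {x c y : ℝ} (hc : 0 ≤ c) (h : ∀ ε : ℝ, 0 < ε → x ≤ c * (y + ε)) :
    x ≤ c * y := by
  refine le_of_forall_pos_le_add fun ε hε => ?_
  refine (h (ε / (c + 1)) (by positivity)).trans ?_
  have : c * (ε / (c + 1)) ≤ ε := by
    rw [mul_div_assoc', div_le_iff₀ (by positivity)]
    nlinarith
  linarith

/-- A real functional that is nonnegative where the selfadjoint part is positive is the real part
of a positive bounded functional. -/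
lemma exists_strongDual_of_real (p : V →ₗ[ℝ] ℝ) (hp : ∀ v, IsPos (selfPart v) → 0 ≤ p v) :
    ∃ P : StrongDual ℂ V, (∀ v, (P v).re = p v) ∧ ∀ v, IsPos v → 0 ≤ P v := by
  -- If the self-adjoint part of an element is `0`, the hypothesis applies to the element and to its
  -- negative, so `p` vanishes there.
  have hself : ∀ v, p (selfPart v) = p v := by
    intro v
    have h0 : selfPart (selfPart v - v) = 0 := by
      rw [selfPart_sub, selfPart_of_star_eq (star_selfPart v), sub_self]
    have h1 := hp (selfPart v - v) (by rw [h0]; exact isPos_zero)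
    have h2 := hp (-(selfPart v - v)) (by rw [selfPart_neg, h0, neg_zero]; exact isPos_zero)
    rw [map_neg] at h2
    rw [map_sub] at h1 h2
    linarith
  set e : V := MatrixOrderUnitSpace.unit with he
  have hse : selfPart e = e := selfPart_of_star_eq MatrixOrderUnitSpace.star_unit
  have hc : 0 ≤ p e := hp e (by rw [hse]; exact isPos_unit)
  -- The self-adjoint part of `v` lies between `-t1` and `t1` with `t` close to `‖v‖`, which bounds
  -- `p` by its value at the unit.
  have hb : ∀ v, ‖p v‖ ≤ p e * ‖v‖ := by
    intro v
    refine le_mul_of_forall_pos hc fun ε hε => ?_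
    obtain ⟨t, ht0, ht, h⟩ := exists_normLE_lt v hε
    have h1 := hp (t • e + v) (by
      rw [selfPart_add, selfPart_smul, hse]
      exact h.isPos_add)
    have h2 := hp (t • e - v) (by
      rw [selfPart_sub, selfPart_smul, hse]
      exact h.isPos_sub)
    rw [map_add, map_smul, smul_eq_mul] at h1
    rw [map_sub, map_smul, smul_eq_mul] at h2
    have h3 : t * p e ≤ p e * (‖v‖ + ε) := by
      rw [mul_comm]
      exact mul_le_mul_of_nonneg_left ht.le hc
    rw [Real.norm_eq_abs, abs_le]
    constructor <;> linarith
  let P : StrongDual ℂ V := StrongDual.extendRCLike (p.mkContinuous (p e) hb)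
  have hre : ∀ v, (P v).re = p v := fun v =>
    Module.Dual.re_extendRCLike_apply (𝕜 := ℂ) p v
  refine ⟨P, hre, fun v hv => ?_⟩
  -- For self-adjoint `v` the element `iv` is skew-adjoint, so `p(iv) = 0`; this number is `-Im
  -- P(v)`.
  have hI : selfPart (Complex.I • v) = 0 := by
    rw [selfPart_apply, star_smul, hv.star_eq, Complex.star_def, Complex.conj_I]
    module
  have him : (P v).im = 0 := by
    have h1 := hre (Complex.I • v)
    rw [← hself, hI, map_zero, map_smul] at h1
    simpa using h1
  rw [Complex.nonneg_iff]
  refine ⟨?_, him.symm⟩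
  rw [hre]
  exact hp v (by rwa [selfPart_of_star_eq hv.star_eq])

/-- Every selfadjoint bounded functional is a difference of positive ones. -/
lemma exists_positive_sub_positive (f : StrongDual ℂ V) (hf : ∀ v, f (star v) = conj (f v)) :
    ∃ P R : StrongDual ℂ V, f = P - R ∧ (∀ v, IsPos v → 0 ≤ P v) ∧ ∀ v, IsPos v → 0 ≤ R v := by
  set e : V := MatrixOrderUnitSpace.unit with he
  -- On the part of this cone where `a + b = 0`, the functional `(a, b, t) ↦ Re f(a) + ‖f‖t` is
  -- nonnegative. A positive extension, restricted to the first and to the second coordinate, gives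
  -- the two parts of `f`.
  let C : PointedCone ℝ (V × V × ℝ) :=
    { carrier := {z | 0 ≤ z.2.2 ∧ IsPos ((z.2.2 : ℂ) • e + selfPart z.1) ∧
        IsPos ((z.2.2 : ℂ) • e + selfPart z.2.1)}
      zero_mem' := by simp [isPos_zero, selfPart_zero]
      add_mem' := by
        rintro ⟨a, b, t⟩ ⟨a', b', t'⟩ ⟨h1, h2, h3⟩ ⟨h1', h2', h3'⟩
        refine ⟨add_nonneg h1 h1', ?_, ?_⟩
        · convert h2.add h2' using 1
          simp only [Prod.mk_add_mk, Complex.ofReal_add, selfPart_add]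
          module
        · convert h3.add h3' using 1
          simp only [Prod.mk_add_mk, Complex.ofReal_add, selfPart_add]
          module
      smul_mem' := by
        rintro ⟨c, hc⟩ ⟨a, b, t⟩ ⟨h1, h2, h3⟩
        refine ⟨mul_nonneg hc h1, ?_, ?_⟩
        · convert h2.smul hc using 1
          rw [smul_add, smul_smul, ← Complex.ofReal_mul, ← selfPart_smul]
          rfl
        · convert h3.smul hc using 1
          rw [smul_add, smul_smul, ← Complex.ofReal_mul, ← selfPart_smul]
          rfl }
  let S : V →ₗ[ℝ] ℝ := Complex.reLm ∘ₗ (f : V →ₗ[ℂ] ℂ).restrictScalars ℝ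
  have hS : ∀ v, S v = (f v).re := fun v => rfl
  have hSself : ∀ v, (S v : ℂ) = f (selfPart v) := by
    intro v
    rw [selfPart_apply, map_smul, map_add, hf v, Complex.add_conj, hS, smul_eq_mul]
    push_cast
    ring
  let L : V × V × ℝ →ₗ[ℝ] ℝ := S ∘ₗ LinearMap.fst ℝ V (V × ℝ) +
    ‖f‖ • (LinearMap.snd ℝ V ℝ ∘ₗ LinearMap.snd ℝ V (V × ℝ))
  let dom : Submodule ℝ (V × V × ℝ) := LinearMap.ker (LinearMap.fst ℝ V (V × ℝ) +
    LinearMap.fst ℝ V ℝ ∘ₗ LinearMap.snd ℝ V (V × ℝ))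
  have hdom : ∀ z : V × V × ℝ, z ∈ dom ↔ z.1 + z.2.1 = 0 := fun z => LinearMap.mem_ker
  have hL : ∀ z : V × V × ℝ, L z = S z.1 + ‖f‖ * z.2.2 := fun z => rfl
  obtain ⟨g, hg1, hg2⟩ := riesz_extension C ⟨dom, L.domRestrict dom⟩ (by
    rintro ⟨⟨a, b, t⟩, hz⟩ ⟨h1, h2, h3⟩
    have hab : a + b = 0 := (hdom _).1 hz
    have hb : selfPart b = -selfPart a := by
      rw [← selfPart_neg, eq_neg_of_add_eq_zero_right hab]
    change 0 ≤ L (a, b, t)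
    rw [hL]
    simp only at h1 h2 h3 ⊢
    rw [hb, ← sub_eq_add_neg] at h3
    -- Since `b = -a`, the two cone conditions bound the self-adjoint part of `a` by `t1` from both
    -- sides, hence its norm by `t`.
    have h4 := norm_le_of_normLE h1 (normLE_of_le (star_selfPart a) h3 h2)
    have h5 : |S a| ≤ ‖f‖ * t := by
      rw [← Real.norm_eq_abs, ← Complex.norm_real, hSself]
      exact (f.le_opNorm _).trans (mul_le_mul_of_nonneg_left h4 (norm_nonneg f))
    linarith [neg_le_of_abs_le h5]) (by
    rintro ⟨a, b, t⟩
    obtain ⟨r, hr, ha⟩ := exists_normLE a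
    obtain ⟨s, hs, hb⟩ := exists_normLE b
    -- The correction changes only the real coordinate, to `r + s`, which is large enough for both
    -- `a` and `b`.
    refine ⟨⟨(0, 0, r + s - t), (hdom _).2 (by simp)⟩, ?_⟩
    refine ⟨?_, ?_, ?_⟩
    · simp only [Prod.mk_add_mk, sub_add_cancel]
      positivity
    · convert ha.isPos_add.add (isPos_unit.smul hs) using 1
      simp only [Prod.mk_add_mk, sub_add_cancel, zero_add, Complex.ofReal_add]
      module
    · convert hb.isPos_add.add (isPos_unit.smul hr) using 1
      simp only [Prod.mk_add_mk, sub_add_cancel, zero_add, Complex.ofReal_add]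
      module)
  obtain ⟨P, hP, hP'⟩ := exists_strongDual_of_real (g ∘ₗ LinearMap.inl ℝ V (V × ℝ))
    (fun v hv => hg2 _ ⟨le_rfl, by simpa using hv, by simpa [selfPart_zero] using isPos_zero⟩)
  obtain ⟨R, hR, hR'⟩ := exists_strongDual_of_real
    (g ∘ₗ LinearMap.inr ℝ V (V × ℝ) ∘ₗ LinearMap.inl ℝ V ℝ)
    (fun v hv => hg2 _ ⟨le_rfl, by simpa [selfPart_zero] using isPos_zero, by simpa using hv⟩)
  -- The triple `(v, -v, 0)` lies in the original domain, where the extension is `Re f(v)`;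
  -- linearity splits it into the two coordinates.
  have hre : ∀ v, (f v).re = ((P - R) v).re := by
    intro v
    have h1 : g (v, -v, 0) = (f v).re := by
      refine (hg1 ⟨(v, -v, 0), (hdom _).2 (by simp)⟩).trans ?_
      change L (v, -v, 0) = _
      rw [hL, hS]
      simp
    have h2 : ((v, -v, 0) : V × V × ℝ) = (v, 0, 0) - (0, v, 0) := by simp
    rw [h2, map_sub] at h1
    rw [sub_apply, Complex.sub_re, hP, hR, ← h1]
    rfl
  refine ⟨P, R, ?_, hP', hR'⟩
  ext v
  apply Complex.ext
  · exact hre v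
  · have h1 := hre (Complex.I • v)
    simp only [map_smul, smul_eq_mul, Complex.mul_re, Complex.I_re, Complex.I_im, zero_mul,
      one_mul, zero_sub, neg_inj] at h1
    exact h1

/-- The adjoint `v ↦ conj (f (v*))` of a functional. -/
noncomputable def adjFun (f : StrongDual ℂ V) : StrongDual ℂ V where
  toFun v := conj (f (star v))
  map_add' v w := by simp
  map_smul' c v := by simp
  cont := Complex.continuous_conj.comp (f.continuous.comp continuous_star)

lemma adjFun_apply (f : StrongDual ℂ V) (v : V) : adjFun f v = conj (f (star v)) := rfl

/-- The entrywise adjoint `F*(v) = F(v*)*` of a matrix of functionals. -/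
noncomputable def matAdj {n : ℕ} (F : Matrix (Fin n) (Fin n) (StrongDual ℂ V)) :
    Matrix (Fin n) (Fin n) (StrongDual ℂ V) :=
  Matrix.of fun i j => adjFun (F j i)

lemma matAdj_apply {n : ℕ} (F : Matrix (Fin n) (Fin n) (StrongDual ℂ V)) (i j : Fin n) (v : V) :
    matAdj F i j v = conj (F j i (star v)) := rfl

/-- Every bounded functional is a combination of four positive ones. -/
lemma exists_four_positive (f : StrongDual ℂ V) :
    ∃ P : Fin 4 → StrongDual ℂ V, ∃ c : Fin 4 → ℂ, (∀ k v, IsPos v → 0 ≤ P k v) ∧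
      f = ∑ k, c k • P k := by
  obtain ⟨P, R, h, hP, hR⟩ := exists_positive_sub_positive ((1 / 2 : ℂ) • (f + adjFun f)) (by
    intro v
    simp only [smul_apply, add_apply, adjFun_apply,
      smul_eq_mul, star_star, map_mul, map_add, Complex.conj_conj, map_div₀, map_one,
      Complex.conj_ofNat]
    ring)
  obtain ⟨P', R', h', hP', hR'⟩ := exists_positive_sub_positive
    ((Complex.I / 2 : ℂ) • (adjFun f - f)) (by
    intro v
    simp only [smul_apply, sub_apply, adjFun_apply,
      smul_eq_mul, star_star, map_mul, map_sub, Complex.conj_conj, map_div₀, Complex.conj_I,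
      Complex.conj_ofNat]
    ring)
  refine ⟨![P, R, P', R'], ![1, -1, Complex.I, -Complex.I], ?_, ?_⟩
  · intro k
    fin_cases k
    exacts [hP, hR, hP', hR']
  · have h1 : f = (1 / 2 : ℂ) • (f + adjFun f) +
        Complex.I • ((Complex.I / 2 : ℂ) • (adjFun f - f)) := by
      rw [smul_smul, ← mul_div_assoc, Complex.I_mul_I]
      module
    rw [h, h'] at h1
    rw [h1, Fin.sum_univ_four]
    simp
    module

end Functionals

/-! ### Completely positive maps into matrices -/

section CompletelyPositive

variable {V : Type*} [AddCommGroup V] [Module ℂ V] [StarAddMonoid V] [StarModule ℂ V]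
  [MatrixOrderUnitSpace V] {m n : ℕ}

lemma amplify_apply {r : ℕ} (φ : Matrix (Fin n) (Fin n) (StrongDual ℂ V))
    (a : Matrix (Fin r) (Fin r) V) (p q : Fin r × Fin n) :
    amplify φ a p q = φ p.2 q.2 (a p.1 q.1) := rfl

lemma IsCompletelyPositive.add {φ ψ : Matrix (Fin n) (Fin n) (StrongDual ℂ V)}
    (hφ : IsCompletelyPositive φ) (hψ : IsCompletelyPositive ψ) :
    IsCompletelyPositive (φ + ψ) := fun r a ha => by
  exact (hφ r a ha).add (hψ r a ha)

lemma IsCompletelyPositive.smul {φ : Matrix (Fin n) (Fin n) (StrongDual ℂ V)}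
    (hφ : IsCompletelyPositive φ) {t : ℝ} (ht : 0 ≤ t) :
    IsCompletelyPositive ((t : ℂ) • φ) := fun r a ha => by
  have h0 : (0 : ℂ) ≤ (t : ℂ) := by exact_mod_cast ht
  have h1 : amplify ((t : ℂ) • φ) a = (t : ℂ) • amplify φ a := rfl
  rw [h1]
  exact (hφ r a ha).smul h0

open scoped Kronecker in
lemma amplify_matProd {r : ℕ} (φ : Matrix (Fin m) (Fin m) (StrongDual ℂ V))
    (α : Matrix (Fin m) (Fin n) ℂ) (a : Matrix (Fin r) (Fin r) V) :
    amplify (matProd αᴴ φ α) a = ((1 : Matrix (Fin r) (Fin r) ℂ) ⊗ₖ α)ᴴ * amplify φ a *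
      ((1 : Matrix (Fin r) (Fin r) ℂ) ⊗ₖ α) := by
  ext ⟨i, i'⟩ ⟨j, j'⟩
  simp only [amplify_apply, matProd_apply, Matrix.mul_apply, Fintype.sum_prod_type,
    Matrix.conjTranspose_apply, Matrix.kroneckerMap_apply, Matrix.one_apply, sum_apply, smul_apply,
    smul_eq_mul, ite_mul, one_mul, zero_mul, mul_ite, mul_zero, apply_ite star, star_zero,
    Finset.sum_ite_irrel,
    Finset.sum_const_zero, Finset.sum_ite_eq',
    Finset.mem_univ, if_true, Finset.sum_mul]
  rw [Finset.sum_comm]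
  refine Finset.sum_congr rfl fun _ _ => Finset.sum_congr rfl fun _ _ => ?_
  ring

lemma IsCompletelyPositive.conj {φ : Matrix (Fin m) (Fin m) (StrongDual ℂ V)}
    (hφ : IsCompletelyPositive φ) (α : Matrix (Fin m) (Fin n) ℂ) :
    IsCompletelyPositive (matProd αᴴ φ α) := fun r a ha => by
  rw [amplify_matProd]
  exact (hφ r a ha).conjTranspose_mul_mul_same _

lemma IsCompletelyPositive.dirSum {φ : Matrix (Fin m) (Fin m) (StrongDual ℂ V)}
    {ψ : Matrix (Fin n) (Fin n) (StrongDual ℂ V)}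
    (hφ : IsCompletelyPositive φ) (hψ : IsCompletelyPositive ψ) :
    IsCompletelyPositive (dirSum φ ψ) := by
  rw [dirSum_eq_add]
  have h1 := hφ.conj (colBlock (1 : Matrix (Fin m) (Fin m) ℂ) (0 : Matrix (Fin n) (Fin m) ℂ))ᴴ
  have h2 := hψ.conj (colBlock (0 : Matrix (Fin m) (Fin n) ℂ) (1 : Matrix (Fin n) (Fin n) ℂ))ᴴ
  rw [Matrix.conjTranspose_conjTranspose] at h1 h2
  exact h1.add h2

lemma selfPart_add_I_smul (v : V) :
    v = selfPart v + Complex.I • selfPart (-Complex.I • v) := by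
  simp only [selfPart_apply, star_smul, star_neg, Complex.star_def, Complex.conj_I, neg_neg]
  match_scalars
  · linear_combination (1 / 2 : ℂ) * Complex.I_mul_I
  · linear_combination (-1 / 2 : ℂ) * Complex.I_mul_I

/-- A positive functional dominates its values on selfadjoint parts. -/
lemma abs_le_of_positive {p : StrongDual ℂ V} (hp : ∀ v, IsPos v → 0 ≤ p v) {v : V} {t : ℝ}
    (h : NormLE v t) : (p (selfPart v)).im = 0 ∧
      |(p (selfPart v)).re| ≤ t * (p MatrixOrderUnitSpace.unit).re := by
  have h0 := Complex.nonneg_iff.1 (hp _ isPos_unit)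
  have h1 := Complex.nonneg_iff.1 (hp _ h.isPos_add)
  have h2 := Complex.nonneg_iff.1 (hp _ h.isPos_sub)
  rw [map_add, map_smul, smul_eq_mul] at h1
  rw [map_sub, map_smul, smul_eq_mul] at h2
  simp only [Complex.add_re, Complex.sub_re, Complex.add_im, Complex.sub_im, Complex.re_ofReal_mul,
    Complex.im_ofReal_mul, ← h0.2, mul_zero] at h1 h2
  refine ⟨by linarith [h1.2], ?_⟩
  rw [abs_le]
  constructor <;> linarith [h1.1, h2.1]

/-- Positive functionals are real on self-adjoint elements, and the Cartesian decomposition reduces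
to these. -/
lemma map_star_of_positive {p : StrongDual ℂ V} (hp : ∀ v, IsPos v → 0 ≤ p v) (v : V) :
    p (star v) = conj (p v) := by
  have hreal : ∀ v, conj (p (selfPart v)) = p (selfPart v) := fun v => by
    obtain ⟨t, -, h⟩ := exists_normLE v
    exact Complex.conj_eq_iff_im.2 (abs_le_of_positive hp h).1
  have h1 : star v = selfPart v - Complex.I • selfPart (-Complex.I • v) := by
    conv_lhs => rw [selfPart_add_I_smul v]
    rw [star_add, star_smul, star_selfPart, star_selfPart, Complex.star_def, Complex.conj_I,
      neg_smul, sub_eq_add_neg]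
  conv_rhs => rw [selfPart_add_I_smul v]
  rw [h1, map_sub, map_add, map_smul, map_add, hreal, smul_eq_mul, map_mul, hreal, Complex.conj_I]
  ring

/-- For a column `x`, `x* p(a) x = p(x* a x)`, and `x* a x` is a positive element of level one.
Hence positivity of a functional already implies complete positivity. -/
lemma posSemidef_map_of_positive {p : StrongDual ℂ V} (hp : ∀ v, IsPos v → 0 ≤ p v) {r : ℕ}
    {a : Matrix (Fin r) (Fin r) V} (ha : a ∈ MatrixOrderedSpace.cone (V := V) r) :
    (a.map p).PosSemidef := by
  refine Matrix.PosSemidef.of_dotProduct_mulVec_nonneg ?_ fun x => ?_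
  · ext i j
    rw [Matrix.conjTranspose_apply, Matrix.map_apply, Matrix.map_apply, Complex.star_def,
      ← map_star_of_positive hp]
    exact congrArg p (congrFun (congrFun (MatrixOrderedSpace.isSelfAdjoint_of_mem ha) i) j)
  · have h1 := MatrixOrderedSpace.conj_mem (Matrix.of fun i (_ : Fin 1) => x i) ha
    have h2 := hp (matProd (Matrix.of fun i (_ : Fin 1) => x i)ᴴ a
      (Matrix.of fun i (_ : Fin 1) => x i) 0 0) (by
        unfold IsPos
        convert h1 using 1
        ext i j
        fin_cases i
        fin_cases j
        rfl)
    convert h2 using 1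
    simp only [matProd_apply, map_sum, map_smul, dotProduct, Matrix.mulVec, Matrix.map_apply,
      Finset.mul_sum, Matrix.conjTranspose_apply, Matrix.of_apply, smul_eq_mul, Pi.star_apply]
    refine Finset.sum_congr rfl fun _ _ => Finset.sum_congr rfl fun _ _ => ?_
    ring

/-- The map `v ↦ p(v) A`. -/
noncomputable def tensorFun (p : StrongDual ℂ V) (A : Matrix (Fin n) (Fin n) ℂ) :
    Matrix (Fin n) (Fin n) (StrongDual ℂ V) :=
  Matrix.of fun i j => A i j • p

lemma tensorFun_apply (p : StrongDual ℂ V) (A : Matrix (Fin n) (Fin n) ℂ) (i j : Fin n) :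
    tensorFun p A i j = A i j • p := rfl

open scoped Kronecker in
lemma isCompletelyPositive_tensorFun {p : StrongDual ℂ V} (hp : ∀ v, IsPos v → 0 ≤ p v)
    {A : Matrix (Fin n) (Fin n) ℂ} (hA : A.PosSemidef) :
    IsCompletelyPositive (tensorFun p A) := fun r a ha => by
  have h1 : amplify (tensorFun p A) a = a.map p ⊗ₖ A := by
    ext i j
    simp [amplify_apply, tensorFun_apply, mul_comm]
  rw [h1]
  exact (posSemidef_map_of_positive hp ha).kronecker hA

/-- Each `v` is the corner of a positive matrix `[[t1, v], [v*, t1]]`, whose image under `φ` is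
Hermitian. -/
lemma IsCompletelyPositive.matAdj_eq {φ : Matrix (Fin n) (Fin n) (StrongDual ℂ V)}
    (hφ : IsCompletelyPositive φ) : matAdj φ = φ := by
  ext i j v
  obtain ⟨t, -, h⟩ := exists_normLE v
  have h1 := congrFun (congrFun (hφ 2 _ h).isHermitian (0, i)) (1, j)
  simpa [amplify_apply, matAdj_apply] using h1

lemma diagonal_mem_cone {r : ℕ} (d : Fin r → ℝ) (hd : ∀ k, 0 ≤ d k) :
    Matrix.diagonal (fun k => (d k : ℂ) • (MatrixOrderUnitSpace.unit : V)) ∈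
      MatrixOrderedSpace.cone (V := V) r := by
  have h1 : ∀ k, (d k : ℂ) • matProd (Matrix.single (0 : Fin 1) k (1 : ℂ))ᴴ
      (oneByOne (MatrixOrderUnitSpace.unit : V)) (Matrix.single (0 : Fin 1) k (1 : ℂ)) ∈
        MatrixOrderedSpace.cone (V := V) r := fun k =>
    MatrixOrderedSpace.smul_mem (hd k) (MatrixOrderedSpace.conj_mem _ isPos_unit)
  have h2 : ∑ k, (d k : ℂ) • matProd (Matrix.single (0 : Fin 1) k (1 : ℂ))ᴴ
      (oneByOne (MatrixOrderUnitSpace.unit : V)) (Matrix.single (0 : Fin 1) k (1 : ℂ)) ∈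
        MatrixOrderedSpace.cone (V := V) r :=
    Finset.sum_induction _ (· ∈ MatrixOrderedSpace.cone (V := V) r)
      (fun _ _ => MatrixOrderedSpace.add_mem) (MatrixOrderedSpace.zero_mem r) fun k _ => h1 k
  convert h2 using 1
  ext i j
  rw [Matrix.sum_apply]
  by_cases hij : i = j
  · subst hij
    simp [matProd_apply, oneByOne, Matrix.single_apply]
  · have : ∀ k, ¬(k = j ∧ k = i) := fun k hk => hij (hk.2.symm.trans hk.1)
    simp [matProd_apply, oneByOne, Matrix.single_apply, hij, ← ite_and, this]

/-- Finiteness of the order norm at all levels. The property is additive in `a`, so a matrix with a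
single nonzero entry suffices. -/
lemma exists_block_mem_cone {r : ℕ} (a : Matrix (Fin r) (Fin r) V) :
    ∃ t : ℝ, 0 ≤ t ∧ blockMat ((t : ℂ) • unitMat V r) a aᴴ ((t : ℂ) • unitMat V r) ∈
      MatrixOrderedSpace.cone (V := V) (r + r) := by
  have hadd : ∀ a b : Matrix (Fin r) (Fin r) V,
      (∃ t : ℝ, 0 ≤ t ∧ blockMat ((t : ℂ) • unitMat V r) a aᴴ ((t : ℂ) • unitMat V r) ∈
        MatrixOrderedSpace.cone (V := V) (r + r)) →
      (∃ t : ℝ, 0 ≤ t ∧ blockMat ((t : ℂ) • unitMat V r) b bᴴ ((t : ℂ) • unitMat V r) ∈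
        MatrixOrderedSpace.cone (V := V) (r + r)) →
      ∃ t : ℝ, 0 ≤ t ∧ blockMat ((t : ℂ) • unitMat V r) (a + b) (a + b)ᴴ
        ((t : ℂ) • unitMat V r) ∈ MatrixOrderedSpace.cone (V := V) (r + r) := by
    rintro a b ⟨s, hs, h1⟩ ⟨t, ht, h2⟩
    refine ⟨s + t, add_nonneg hs ht, ?_⟩
    convert MatrixOrderedSpace.add_mem h1 h2 using 1
    apply ext_blocks <;> intro i j <;> simp [-Fin.natAdd_eq_addNat, add_smul]
  have hzero : ∃ t : ℝ, 0 ≤ t ∧ blockMat ((t : ℂ) • unitMat V r) (0 : Matrix (Fin r) (Fin r) V) 0ᴴ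
      ((t : ℂ) • unitMat V r) ∈ MatrixOrderedSpace.cone (V := V) (r + r) := by
    refine ⟨0, le_rfl, ?_⟩
    convert MatrixOrderedSpace.zero_mem (V := V) (r + r) using 1
    apply ext_blocks <;> intro i j <;> simp [-Fin.natAdd_eq_addNat]
  rw [Matrix.matrix_eq_sum_single a]
  refine Finset.sum_induction _ _ hadd hzero fun i _ =>
    Finset.sum_induction _ _ hadd hzero fun j _ => ?_
  obtain ⟨t, ht, h⟩ := exists_normLE (a i j)
  refine ⟨t, ht, ?_⟩
  -- Conjugation moves the `2 × 2` matrix of the entry to the indices `i` and `r + j`; the diagonal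
  -- matrix in `h2` supplies `t` at all the others.
  have h1 := MatrixOrderedSpace.conj_mem
    (Matrix.of ![Pi.single (Fin.castAdd r i) 1, Pi.single (Fin.natAdd r j) 1] :
      Matrix (Fin 2) (Fin (r + r)) ℂ) h
  have h2 := diagonal_mem_cone (V := V) (Fin.append (fun k => if k = i then 0 else t)
    (fun k => if k = j then 0 else t)) (fun k => by
      refine Fin.addCases (fun k => ?_) (fun k => ?_) k
      · rw [Fin.append_left]
        split_ifs <;> simp [ht]
      · rw [Fin.append_right]
        split_ifs <;> simp [ht])
  convert MatrixOrderedSpace.add_mem h1 h2 using 1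
  have hne : ∀ i j : Fin r, Fin.castAdd r i ≠ Fin.natAdd r j := fun i j => by
    simp only [ne_eq, Fin.ext_iff, Fin.val_castAdd, Fin.val_natAdd]
    omega
  apply ext_blocks <;> intro k l <;>
    simp [-Fin.natAdd_eq_addNat, -Complex.coe_smul, unitMat, matProd_apply, Fin.sum_univ_two,
      Matrix.diagonal_apply, Pi.single_apply, hne, (hne _ _).symm, Matrix.single_apply]
  all_goals clear h1 h2 hadd hzero h hne; grind [Complex.ofReal_zero, zero_smul, add_zero, zero_add]

end CompletelyPositive

/-! ### Matrix states and their differences -/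

section MatrixStates

variable {V : Type*} [AddCommGroup V] [Module ℂ V] [StarAddMonoid V] [StarModule ℂ V]
  [MatrixOrderUnitSpace V] {m n : ℕ}

/-- The matrix `F(1)`. -/
noncomputable def atUnit (F : Matrix (Fin n) (Fin n) (StrongDual ℂ V)) : Matrix (Fin n) (Fin n) ℂ :=
  Matrix.of fun i j => F i j MatrixOrderUnitSpace.unit

lemma atUnit_add (F G : Matrix (Fin n) (Fin n) (StrongDual ℂ V)) :
    atUnit (F + G) = atUnit F + atUnit G := rfl

lemma atUnit_sub (F G : Matrix (Fin n) (Fin n) (StrongDual ℂ V)) :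
    atUnit (F - G) = atUnit F - atUnit G := rfl

lemma atUnit_smul (c : ℂ) (F : Matrix (Fin n) (Fin n) (StrongDual ℂ V)) :
    atUnit (c • F) = c • atUnit F := rfl

lemma atUnit_matProd (α : Matrix (Fin n) (Fin m) ℂ)
    (F : Matrix (Fin m) (Fin m) (StrongDual ℂ V)) (β : Matrix (Fin m) (Fin n) ℂ) :
    atUnit (matProd α F β) = α * atUnit F * β := by
  ext i j
  simp only [atUnit, matProd_apply, Matrix.of_apply, sum_apply, smul_apply, Matrix.mul_apply,
    smul_eq_mul, Finset.sum_mul]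
  rw [Finset.sum_comm]
  refine Finset.sum_congr rfl fun _ _ => Finset.sum_congr rfl fun _ _ => ?_
  ring

lemma IsCompletelyPositive.isHermitian_atUnit {φ : Matrix (Fin n) (Fin n) (StrongDual ℂ V)}
    (hφ : IsCompletelyPositive φ) : (atUnit φ).IsHermitian := by
  ext i j
  conv_rhs => rw [← hφ.matAdj_eq]
  simp [atUnit, matAdj_apply, MatrixOrderUnitSpace.star_unit]

lemma amplify_conjTranspose {r : ℕ} {φ : Matrix (Fin n) (Fin n) (StrongDual ℂ V)}
    (hφ : matAdj φ = φ) (a : Matrix (Fin r) (Fin r) V) :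
    amplify φ aᴴ = (amplify φ a)ᴴ := by
  ext p q
  conv_lhs => rw [← hφ]
  simp [amplify_apply, matAdj_apply]

lemma amplify_smul_unitMat {r : ℕ} {φ : Matrix (Fin n) (Fin n) (StrongDual ℂ V)}
    (h1 : atUnit φ = 1) (t : ℂ) : amplify φ (t • unitMat V r) = t • 1 := by
  ext ⟨i, k⟩ ⟨j, l⟩
  have h2 : φ k l MatrixOrderUnitSpace.unit = (1 : Matrix (Fin n) (Fin n) ℂ) k l :=
    congrFun (congrFun h1 k) l
  by_cases hij : i = j
  · subst hij
    simp [amplify_apply, unitMat, h2, Matrix.one_apply]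
  · simp [amplify_apply, unitMat, hij]

/-- Unital completely positive maps are completely contractive. -/
lemma IsCompletelyPositive.isCompletelyBounded {φ : Matrix (Fin n) (Fin n) (StrongDual ℂ V)}
    (hφ : IsCompletelyPositive φ) (h1 : atUnit φ = 1) : IsCompletelyBounded φ := by
  refine ⟨1, fun r a => ?_⟩
  rw [one_mul]
  -- Nonemptiness matters: the infimum of the empty set is `0` by convention and would bound
  -- nothing.
  refine le_csInf (exists_block_mem_cone a) ?_
  rintro t ⟨ht, h⟩
  refine norm_le_of_posSemidef_fromBlocks ht ?_
  convert (hφ _ _ h).submatrix (Sum.elim (fun p : Fin r × Fin n => (Fin.castAdd r p.1, p.2))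
    (fun p : Fin r × Fin n => (Fin.natAdd r p.1, p.2))) using 1
  rw [← amplify_smul_unitMat h1, ← amplify_conjTranspose hφ.matAdj_eq]
  ext (p | p) (q | q) <;> simp [-Fin.natAdd_eq_addNat, amplify_apply]

/-- Complete boundedness is automatic for unital completely positive maps, so it need not be tracked
any further. -/
lemma mem_matrixStates_iff {φ : Matrix (Fin n) (Fin n) (StrongDual ℂ V)} :
    φ ∈ matrixStates V n ↔ IsCompletelyPositive φ ∧ atUnit φ = 1 :=
  ⟨fun h => h.2, fun h => ⟨h.1.isCompletelyBounded h.2, h⟩⟩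

lemma convexComb_mem_matrixStates {φ ψ : Matrix (Fin n) (Fin n) (StrongDual ℂ V)}
    (hφ : φ ∈ matrixStates V n) (hψ : ψ ∈ matrixStates V n) {t : ℝ} (h0 : 0 ≤ t) (h1 : t ≤ 1) :
    (t : ℂ) • φ + ((1 - t : ℝ) : ℂ) • ψ ∈ matrixStates V n := by
  rw [mem_matrixStates_iff] at *
  refine ⟨(hφ.1.smul h0).add (hψ.1.smul (sub_nonneg.2 h1)), ?_⟩
  rw [atUnit_add, atUnit_smul, atUnit_smul, hφ.2, hψ.2, ← add_smul, ← Complex.ofReal_add]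
  simp

lemma atUnit_dirSum (F : Matrix (Fin m) (Fin m) (StrongDual ℂ V))
    (G : Matrix (Fin n) (Fin n) (StrongDual ℂ V)) :
    atUnit (dirSum F G) = blockMat (atUnit F) 0 0 (atUnit G) := by
  apply ext_blocks <;> intro i j <;> simp [-Fin.natAdd_eq_addNat, atUnit, dirSum]

lemma dirSum_mem_matrixStates {φ : Matrix (Fin m) (Fin m) (StrongDual ℂ V)}
    {ψ : Matrix (Fin n) (Fin n) (StrongDual ℂ V)}
    (hφ : φ ∈ matrixStates V m) (hψ : ψ ∈ matrixStates V n) :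
    dirSum φ ψ ∈ matrixStates V (m + n) := by
  rw [mem_matrixStates_iff] at *
  refine ⟨hφ.1.dirSum hψ.1, ?_⟩
  rw [atUnit_dirSum, hφ.2, hψ.2]
  simp [blockMat]

lemma compress_mem_matrixStates {φ : Matrix (Fin m) (Fin m) (StrongDual ℂ V)}
    (hφ : φ ∈ matrixStates V m) {α : Matrix (Fin m) (Fin n) ℂ} (hα : αᴴ * α = 1) :
    matProd αᴴ φ α ∈ matrixStates V n := by
  rw [mem_matrixStates_iff] at *
  refine ⟨hφ.1.conj α, ?_⟩
  rw [atUnit_matProd, hφ.2, Matrix.mul_one, hα]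

/-- `F` is a difference of completely positive maps. -/
def IsDiffCP (F : Matrix (Fin n) (Fin n) (StrongDual ℂ V)) : Prop :=
  ∃ G H : Matrix (Fin n) (Fin n) (StrongDual ℂ V),
    IsCompletelyPositive G ∧ IsCompletelyPositive H ∧ F = G - H

lemma IsDiffCP.add {F F' : Matrix (Fin n) (Fin n) (StrongDual ℂ V)} (h : IsDiffCP F)
    (h' : IsDiffCP F') : IsDiffCP (F + F') := by
  obtain ⟨G, H, hG, hH, rfl⟩ := h
  obtain ⟨G', H', hG', hH', rfl⟩ := h'
  exact ⟨_, _, hG.add hG', hH.add hH', by abel⟩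

lemma IsDiffCP.smul {F : Matrix (Fin n) (Fin n) (StrongDual ℂ V)} (h : IsDiffCP F) {t : ℝ}
    (ht : 0 ≤ t) : IsDiffCP ((t : ℂ) • F) := by
  obtain ⟨G, H, hG, hH, rfl⟩ := h
  exact ⟨_, _, hG.smul ht, hH.smul ht, smul_sub _ _ _⟩

/-- The splitting `A = (‖A‖1 + A) - ‖A‖1` has positive semidefinite parts. -/
lemma isDiffCP_tensorFun {p : StrongDual ℂ V} (hp : ∀ v, IsPos v → 0 ≤ p v)
    {A : Matrix (Fin n) (Fin n) ℂ} (hA : A.IsHermitian) : IsDiffCP (tensorFun p A) := by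
  have h0 : (0 : ℂ) ≤ ((‖A‖ : ℝ) : ℂ) := by exact_mod_cast norm_nonneg A
  refine ⟨_, _, isCompletelyPositive_tensorFun hp (posSemidef_smul_one_add hA le_rfl),
    isCompletelyPositive_tensorFun hp (Matrix.PosSemidef.one.smul h0), ?_⟩
  ext i j v
  simp [tensorFun_apply, add_mul]

lemma isDiffCP_zero : IsDiffCP (0 : Matrix (Fin n) (Fin n) (StrongDual ℂ V)) := by
  have h0 : IsCompletelyPositive (0 : Matrix (Fin n) (Fin n) (StrongDual ℂ V)) :=
    fun r a _ => Matrix.PosSemidef.zero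
  exact ⟨0, 0, h0, h0, (sub_zero _).symm⟩

/-- By additivity and the decomposition into four positive functionals, only one entry `cp` with `p`
positive matters. Its symmetrisation is `p` with the Hermitian coefficient `cE + (cE)*`, where `E`
is a matrix unit. -/
lemma isDiffCP_add_matAdj (F : Matrix (Fin n) (Fin n) (StrongDual ℂ V)) :
    IsDiffCP (F + matAdj F) := by
  have h1 : ∀ (i j : Fin n) (p : StrongDual ℂ V) (c : ℂ), (∀ v, IsPos v → 0 ≤ p v) →
      IsDiffCP (Matrix.single i j (c • p) + matAdj (Matrix.single i j (c • p))) := by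
    intro i j p c hp
    have hA : (Matrix.single i j c + (Matrix.single i j c)ᴴ).IsHermitian := by
      rw [Matrix.IsHermitian, Matrix.conjTranspose_add, Matrix.conjTranspose_conjTranspose,
        add_comm]
    convert isDiffCP_tensorFun hp hA using 1
    ext k l v
    simp only [Matrix.add_apply, add_apply, matAdj_apply, Matrix.single_apply, tensorFun_apply,
      smul_apply, Matrix.conjTranspose_apply, smul_eq_mul, add_mul]
    split_ifs <;> simp [map_star_of_positive hp]
  have h2 : F + matAdj F = ∑ i, ∑ j, (Matrix.single i j (F i j) +
      matAdj (Matrix.single i j (F i j))) := by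
    have h3 : matAdj F = ∑ i, ∑ j, matAdj (Matrix.single i j (F i j)) := by
      ext k l v
      simp only [matAdj_apply, Matrix.sum_apply, sum_apply, Matrix.single_apply]
      rw [Finset.sum_eq_single l, Finset.sum_eq_single k] <;> simp +contextual
    simp only [Finset.sum_add_distrib]
    rw [← h3, ← Matrix.matrix_eq_sum_single F]
  rw [h2]
  refine Finset.sum_induction _ _ (fun _ _ => IsDiffCP.add) isDiffCP_zero fun i _ =>
    Finset.sum_induction _ _ (fun _ _ => IsDiffCP.add) isDiffCP_zero fun j _ => ?_
  obtain ⟨P, c, hP, h⟩ := exists_four_positive (F i j)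
  have h4 : Matrix.single i j (F i j) + matAdj (Matrix.single i j (F i j)) =
      ∑ k, (Matrix.single i j (c k • P k) + matAdj (Matrix.single i j (c k • P k))) := by
    rw [h]
    ext k l v
    simp only [Matrix.add_apply, add_apply, matAdj_apply, Matrix.single_apply, Matrix.sum_apply,
      sum_apply, Finset.sum_add_distrib]
    split_ifs <;> simp [sum_apply, map_sum]
  rw [h4]
  exact Finset.sum_induction _ _ (fun _ _ => IsDiffCP.add) isDiffCP_zero fun k _ =>
    h1 i j (P k) (c k) (hP k)

lemma positive_of_matrixState {σ : Matrix (Fin 1) (Fin 1) (StrongDual ℂ V)}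
    (hσ : IsCompletelyPositive σ) (v : V) (hv : IsPos v) : 0 ≤ σ 0 0 v :=
  (hσ 1 (oneByOne v) hv).diag_nonneg (i := (0, 0))

/-- Selfadjoint maps vanishing at `1` are multiples of differences of matrix states. -/
lemma exists_eq_smul_sub {F : Matrix (Fin n) (Fin n) (StrongDual ℂ V)} (hF : matAdj F = F)
    (hF1 : atUnit F = 0) (hne : (matrixStates V 1).Nonempty) :
    ∃ (c : ℝ) (φ ψ : matrixStates V n), 0 ≤ c ∧ F = (c : ℂ) • (φ.1 - ψ.1) := by
  obtain ⟨σ, hσ⟩ := hne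
  rw [mem_matrixStates_iff] at hσ
  obtain ⟨G, H, hG, hH, hGH⟩ : IsDiffCP F := by
    have h := (isDiffCP_add_matAdj F).smul (t := 1 / 2) (by norm_num)
    rw [hF, ← two_smul ℂ F, smul_smul] at h
    norm_num at h
    exact h
  have hunit : atUnit H = atUnit G := by
    rw [hGH, atUnit_sub, sub_eq_zero] at hF1
    exact hF1.symm
  -- At least `‖G(1)‖`, so that `c1 - G(1)` is positive semidefinite, and nonzero, so that one can
  -- divide by it.
  set c : ℝ := ‖atUnit G‖ + 1 with hc
  have hc0 : 0 < c := by positivity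
  have hcC : (c : ℂ) ≠ 0 := by exact_mod_cast hc0.ne'
  have hX := isCompletelyPositive_tensorFun (positive_of_matrixState hσ.1)
    (posSemidef_smul_one_sub hG.isHermitian_atUnit (t := c) (by rw [hc]; linarith))
  -- Since `G(1) = H(1)`, adding `X` to both `G` and `H` keeps their difference and makes both
  -- values at the unit equal to `c1`.
  set X := tensorFun (σ 0 0) ((c : ℂ) • 1 - atUnit G) with hXdef
  have hX1 : atUnit X = (c : ℂ) • 1 - atUnit G := by
    have h1 : σ 0 0 MatrixOrderUnitSpace.unit = 1 := congrFun (congrFun hσ.2 0) 0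
    ext i j
    simp only [atUnit, hXdef, tensorFun_apply, Matrix.of_apply, smul_apply, h1, smul_eq_mul,
      mul_one]
  have hmem : ∀ K : Matrix (Fin n) (Fin n) (StrongDual ℂ V), IsCompletelyPositive K →
      atUnit K = atUnit G → ((c⁻¹ : ℝ) : ℂ) • (K + X) ∈ matrixStates V n := by
    intro K hK hK1
    rw [mem_matrixStates_iff]
    refine ⟨(hK.add hX).smul (inv_nonneg.2 hc0.le), ?_⟩
    rw [atUnit_smul, atUnit_add, hK1, hX1, add_sub_cancel, smul_smul, Complex.ofReal_inv,
      inv_mul_cancel₀ hcC, one_smul]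
  refine ⟨c, ⟨_, hmem G hG rfl⟩, ⟨_, hmem H hH hunit⟩, hc0.le, ?_⟩
  simp only
  rw [hGH]
  ext i j v
  simp only [Matrix.sub_apply, Matrix.add_apply, Matrix.smul_apply, sub_apply, add_apply,
    smul_apply, smul_eq_mul, Complex.ofReal_inv]
  field_simp
  ring

/-- A positive functional with `p(1) ≠ 0` could be normalised to a state, and one with `p(1) = 0`
vanishes because `p(1)` controls it. Positive functionals span the dual. -/
lemma strongDual_eq_zero_of_no_states (h : ¬(matrixStates V 1).Nonempty) (f : StrongDual ℂ V) :
    f = 0 := by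
  have hpos : ∀ p : StrongDual ℂ V, (∀ v, IsPos v → 0 ≤ p v) → p = 0 := by
    intro p hp
    have h0 := Complex.nonneg_iff.1 (hp _ isPos_unit)
    set r := (p MatrixOrderUnitSpace.unit).re with hr
    have hpr : p MatrixOrderUnitSpace.unit = (r : ℂ) := Complex.ext rfl (by simp [← h0.2])
    have hr0 : r = 0 := by
      by_contra hne
      have hrC : (r : ℂ) ≠ 0 := by exact_mod_cast hne
      refine h ⟨((r⁻¹ : ℝ) : ℂ) • tensorFun p 1, mem_matrixStates_iff.2
        ⟨(isCompletelyPositive_tensorFun hp Matrix.PosSemidef.one).smul (inv_nonneg.2 h0.1), ?_⟩⟩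
      ext i j
      fin_cases i
      fin_cases j
      simp [-Complex.coe_smul, atUnit, tensorFun_apply, hpr, hrC]
    have hself : ∀ v, p (selfPart v) = 0 := by
      intro v
      obtain ⟨t, -, ht⟩ := exists_normLE v
      obtain ⟨h1, h2⟩ := abs_le_of_positive hp ht
      rw [← hr, hr0, mul_zero] at h2
      exact Complex.ext (abs_nonpos_iff.1 h2) h1
    ext v
    rw [selfPart_add_I_smul v, map_add, map_smul, hself, hself]
    simp
  obtain ⟨P, c, hP, hf⟩ := exists_four_positive f
  rw [hf]
  exact Finset.sum_eq_zero fun k _ => by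
    rw [hpos _ (hP k)]
    exact smul_zero (A := StrongDual ℂ V) (c k)

end MatrixStates

/-! ### The norm on multiples of differences in a matrix convex set -/

section DiffNorm

variable {W : Type*} [AddCommGroup W] [Module ℂ W]
  {K : ∀ n : ℕ, Set (Matrix (Fin n) (Fin n) W)}

/-- `K = (K_n)` is a matrix convex set. -/
structure IsMatrixConvex (K : ∀ n : ℕ, Set (Matrix (Fin n) (Fin n) W)) : Prop where
  convexComb_mem : ∀ {n : ℕ} {x y : Matrix (Fin n) (Fin n) W}, x ∈ K n → y ∈ K n →
    ∀ {t : ℝ}, 0 ≤ t → t ≤ 1 → (t : ℂ) • x + ((1 - t : ℝ) : ℂ) • y ∈ K n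
  dirSum_mem : ∀ {m n : ℕ} {x : Matrix (Fin m) (Fin m) W} {y : Matrix (Fin n) (Fin n) W},
    x ∈ K m → y ∈ K n → dirSum x y ∈ K (m + n)
  compress_mem : ∀ {m n : ℕ} {x : Matrix (Fin m) (Fin m) W} {α : Matrix (Fin m) (Fin n) ℂ},
    x ∈ K m → αᴴ * α = 1 → matProd αᴴ x α ∈ K n

lemma IsMatrixConvex.nonempty (hK : IsMatrixConvex K) (h : (K 1).Nonempty) (n : ℕ) :
    (K n).Nonempty := by
  obtain ⟨x, hx⟩ := h
  induction n with
  | zero =>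
    -- Level `0` is included: the empty `1 × 0` matrix is an isometry.
    exact ⟨_, hK.compress_mem (α := (0 : Matrix (Fin 1) (Fin 0) ℂ)) hx (by ext i; exact i.elim0)⟩
  | succ n ih =>
    obtain ⟨y, hy⟩ := ih
    exact ⟨_, hK.dirSum_mem hy hx⟩

/-- `F` is a nonnegative multiple of a difference of elements of `K_n`. -/
def IsDiff (K : ∀ n : ℕ, Set (Matrix (Fin n) (Fin n) W)) {n : ℕ} (F : Matrix (Fin n) (Fin n) W) :
    Prop :=
  ∃ (c : ℝ) (x y : K n), 0 ≤ c ∧ F = (c : ℂ) • (x.1 - y.1)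

open Classical in
/-- The function `c (x - y) ↦ c D(x, y)`. -/
noncomputable def diffNorm (D : ∀ n : ℕ, K n → K n → ℝ) {n : ℕ} (F : Matrix (Fin n) (Fin n) W) :
    ℝ :=
  if h : IsDiff K F then
    h.choose * D n h.choose_spec.choose h.choose_spec.choose_spec.choose
  else 0

/-- The conditions on the metrics under which they come from a norm. -/
structure IsNormLike (D : ∀ n : ℕ, K n → K n → ℝ) : Prop where
  isMatrixMetric : IsMatrixMetric D
  isConvexMetric : ∀ n, IsConvexMetric (D n)
  isMidpointBalanced : ∀ n, IsMidpointBalanced (D n)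
  isMidpointConcave : ∀ n, IsMidpointConcave (D n)

variable {D : ∀ n : ℕ, K n → K n → ℝ} {m n : ℕ}

lemma IsMetric.self_eq_zero {X : Type*} {ρ : X → X → ℝ} (h : IsMetric ρ) (x : X) : ρ x x = 0 :=
  (h.eq_zero_iff x x).2 rfl

/-- Equal differences mean that `x, y'` and `x', y` have the same midpoint. -/
lemma IsNormLike.eq_of_sub_eq (hD : IsNormLike D) {x y x' y' : K n}
    (h : x.1 - y.1 = x'.1 - y'.1) : D n x y = D n x' y' := by
  refine hD.isMidpointBalanced n x x' y y' ?_
  rw [sub_eq_sub_iff_add_eq_add.1 h]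

/-- For `w = tx + (1-t)y`, convexity gives `D(w, y) ≤ t D(x, y)` and `D(x, w) ≤ (1-t) D(x, y)`. The
bounds add up to `D(x, y)`, so the triangle inequality forces equality in both. -/
lemma IsNormLike.eq_mul_of_sub_eq (hD : IsNormLike D) (hK : IsMatrixConvex K) {x y x' y' : K n}
    {t : ℝ} (h0 : 0 ≤ t) (h1 : t ≤ 1) (h : x'.1 - y'.1 = (t : ℂ) • (x.1 - y.1)) :
    D n x' y' = t * D n x y := by
  let w : K n := ⟨_, hK.convexComb_mem x.2 y.2 h0 h1⟩
  have hw : w.1 = (t : ℂ) • x.1 + ((1 - t : ℝ) : ℂ) • y.1 := rfl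
  have hM := hD.isMatrixMetric.isMetric n
  have h2 : D n x' y' = D n w y := hD.eq_of_sub_eq (by
    rw [h, hw]
    push_cast
    module)
  have h3 := hD.isConvexMetric n y x y w t h0 h1 hw
  have h4 := hD.isConvexMetric n x x y w t h0 h1 hw
  have h5 := hM.triangle x w y
  rw [hM.self_eq_zero] at h3 h4
  rw [hM.symm y w, hM.symm y x] at h3
  rw [h2]
  linarith

lemma IsNormLike.mul_eq_mul_of_le (hD : IsNormLike D) (hK : IsMatrixConvex K) {x y x' y' : K n}
    {c c' : ℝ} (h0 : 0 ≤ c) (hle : c ≤ c')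
    (h : (c : ℂ) • (x.1 - y.1) = (c' : ℂ) • (x'.1 - y'.1)) : c * D n x y = c' * D n x' y' := by
  rcases (h0.trans hle).eq_or_lt with h1 | h1
  · rw [← h1] at hle ⊢
    rw [le_antisymm hle h0, zero_mul, zero_mul]
  · have hc : (c' : ℂ) ≠ 0 := by exact_mod_cast h1.ne'
    rw [hD.eq_mul_of_sub_eq hK (t := c / c') (x := x) (y := y) (x' := x') (y' := y')
      (by positivity)
      ((div_le_one h1).2 hle)]
    · field_simp
    · rw [Complex.ofReal_div, div_eq_inv_mul, mul_smul, h, smul_smul, inv_mul_cancel₀ hc, one_smul]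

/-- The value is independent of the chosen representation: the smaller of two factors is a multiple
in `[0, 1]` of the larger, and homogeneity compares them. -/
lemma IsNormLike.diffNorm_eq (hD : IsNormLike D) (hK : IsMatrixConvex K)
    {F : Matrix (Fin n) (Fin n) W} {c : ℝ} {x y : K n} (hc : 0 ≤ c)
    (h : F = (c : ℂ) • (x.1 - y.1)) : diffNorm D F = c * D n x y := by
  have hF : IsDiff K F := ⟨c, x, y, hc, h⟩
  rw [diffNorm, dif_pos hF]
  obtain ⟨h0, h1⟩ := hF.choose_spec.choose_spec.choose_spec
  rcases le_total c hF.choose with hle | hle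
  · exact (hD.mul_eq_mul_of_le hK hc hle (h.symm.trans h1)).symm
  · exact hD.mul_eq_mul_of_le hK h0 hle (h1.symm.trans h)

lemma IsMatrixConvex.exists_rescale (hK : IsMatrixConvex K) {c c' : ℝ} (x y : K n) (hc : 0 ≤ c)
    (hle : c ≤ c') (hc' : 0 < c') :
    ∃ w : K n, (c : ℂ) • (x.1 - y.1) = (c' : ℂ) • (w.1 - y.1) := by
  have hC : (c' : ℂ) ≠ 0 := by exact_mod_cast hc'.ne'
  refine ⟨⟨_, hK.convexComb_mem x.2 y.2 (t := c / c') (by positivity) ((div_le_one hc').2 hle)⟩, ?_⟩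
  push_cast
  match_scalars <;> field_simp
  ring

lemma IsMatrixConvex.exists_common (hK : IsMatrixConvex K) {F : Matrix (Fin m) (Fin m) W}
    {G : Matrix (Fin n) (Fin n) W} (hF : IsDiff K F) (hG : IsDiff K G) :
    ∃ (c : ℝ) (x y : K m) (u v : K n), 0 ≤ c ∧ F = (c : ℂ) • (x.1 - y.1) ∧
      G = (c : ℂ) • (u.1 - v.1) := by
  obtain ⟨c, x, y, hc, rfl⟩ := hF
  obtain ⟨d, u, v, hd, rfl⟩ := hG
  -- The extra `1` keeps the common factor positive even if `c = d = 0`.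
  obtain ⟨w, hw⟩ := hK.exists_rescale (c' := c + d + 1) x y hc (by linarith) (by linarith)
  obtain ⟨z, hz⟩ := hK.exists_rescale (c' := c + d + 1) u v hd (by linarith) (by linarith)
  exact ⟨c + d + 1, w, y, z, v, by linarith, hw, hz⟩

lemma IsNormLike.diffNorm_nonneg (hD : IsNormLike D) (F : Matrix (Fin n) (Fin n) W) :
    0 ≤ diffNorm D F := by
  unfold diffNorm
  split_ifs with h
  · exact mul_nonneg h.choose_spec.choose_spec.choose_spec.1
      ((hD.isMatrixMetric.isMetric n).nonneg _ _)
  · exact le_rfl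

lemma IsNormLike.eq_zero_of_diffNorm_eq_zero (hD : IsNormLike D) (hK : IsMatrixConvex K)
    {F : Matrix (Fin n) (Fin n) W} (hF : IsDiff K F) (h : diffNorm D F = 0) : F = 0 := by
  obtain ⟨c, x, y, hc, rfl⟩ := hF
  rw [hD.diffNorm_eq hK hc rfl] at h
  rcases mul_eq_zero.1 h with h | h
  · simp [h]
  · rw [((hD.isMatrixMetric.isMetric n).eq_zero_iff x y).1 h]
    simp

/-- Over a common factor `c`, the sum is `2c` times a difference of midpoints, which is the
situation of midpoint concavity. -/
lemma IsNormLike.diffNorm_add_le (hD : IsNormLike D) (hK : IsMatrixConvex K)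
    {F G : Matrix (Fin n) (Fin n) W} (hF : IsDiff K F) (hG : IsDiff K G) :
    diffNorm D (F + G) ≤ diffNorm D F + diffNorm D G := by
  obtain ⟨c, x, y, u, v, hc, hF', hG'⟩ := hK.exists_common hF hG
  let p : K n := ⟨_, hK.convexComb_mem x.2 u.2 (t := 1 / 2) (by norm_num) (by norm_num)⟩
  let q : K n := ⟨_, hK.convexComb_mem y.2 v.2 (t := 1 / 2) (by norm_num) (by norm_num)⟩
  have hp : p.1 = (1 / 2 : ℂ) • (x.1 + u.1) := by
    simp only [p]
    push_cast
    module
  have hq : q.1 = (1 / 2 : ℂ) • (y.1 + v.1) := by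
    simp only [q]
    push_cast
    module
  have h1 : F + G = ((2 * c : ℝ) : ℂ) • (p.1 - q.1) := by
    rw [hF', hG', hp, hq]
    push_cast
    module
  rw [hD.diffNorm_eq hK (by positivity) h1, hD.diffNorm_eq hK hc hF', hD.diffNorm_eq hK hc hG']
  have h2 := mul_le_mul_of_nonneg_left (hD.isMidpointConcave n x y u v p q hp hq) hc
  linarith

lemma IsNormLike.diffNorm_smul (hD : IsNormLike D) (hK : IsMatrixConvex K)
    {F : Matrix (Fin n) (Fin n) W} (hF : IsDiff K F) {t : ℝ} (ht : 0 ≤ t) :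
    diffNorm D ((t : ℂ) • F) = t * diffNorm D F := by
  obtain ⟨c, x, y, hc, rfl⟩ := hF
  rw [hD.diffNorm_eq hK hc rfl, hD.diffNorm_eq hK (c := t * c) (x := x) (y := y) (by positivity),
    mul_assoc]
  rw [Complex.ofReal_mul, mul_smul]

lemma IsDiff.neg {F : Matrix (Fin n) (Fin n) W} (hF : IsDiff K F) : IsDiff K (-F) := by
  obtain ⟨c, x, y, hc, rfl⟩ := hF
  exact ⟨c, y, x, hc, by rw [← smul_neg, neg_sub]⟩

lemma IsNormLike.diffNorm_neg (hD : IsNormLike D) (hK : IsMatrixConvex K)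
    {F : Matrix (Fin n) (Fin n) W} (hF : IsDiff K F) : diffNorm D (-F) = diffNorm D F := by
  obtain ⟨c, x, y, hc, rfl⟩ := hF
  rw [hD.diffNorm_eq hK hc rfl, (hD.isMatrixMetric.isMetric n).symm,
    hD.diffNorm_eq hK (c := c) (x := y) (y := x) hc (by rw [← smul_neg, neg_sub])]

lemma IsMatrixConvex.isDiff_dirSum (hK : IsMatrixConvex K) {F : Matrix (Fin m) (Fin m) W}
    {G : Matrix (Fin n) (Fin n) W} (hF : IsDiff K F) (hG : IsDiff K G) :
    IsDiff K (dirSum F G) := by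
  obtain ⟨c, x, y, u, v, hc, rfl, rfl⟩ := hK.exists_common hF hG
  exact ⟨c, ⟨_, hK.dirSum_mem x.2 u.2⟩, ⟨_, hK.dirSum_mem y.2 v.2⟩, hc,
    by rw [dirSum_smul, dirSum_sub]⟩

lemma IsNormLike.diffNorm_dirSum (hD : IsNormLike D) (hK : IsMatrixConvex K)
    {F : Matrix (Fin m) (Fin m) W} {G : Matrix (Fin n) (Fin n) W} (hF : IsDiff K F)
    (hG : IsDiff K G) : diffNorm D (dirSum F G) = max (diffNorm D F) (diffNorm D G) := by
  obtain ⟨c, x, y, u, v, hc, rfl, rfl⟩ := hK.exists_common hF hG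
  rw [hD.diffNorm_eq hK hc rfl, hD.diffNorm_eq hK hc rfl, ← mul_max_of_nonneg _ _ hc,
    ← hD.isMatrixMetric.dirSum_eq m n x y u v ⟨_, hK.dirSum_mem x.2 u.2⟩
      ⟨_, hK.dirSum_mem y.2 v.2⟩ rfl rfl]
  exact hD.diffNorm_eq hK hc (by rw [dirSum_smul, dirSum_sub])

lemma IsMatrixConvex.isDiff_compress (hK : IsMatrixConvex K) {F : Matrix (Fin m) (Fin m) W}
    (hF : IsDiff K F) {α : Matrix (Fin m) (Fin n) ℂ} (hα : αᴴ * α = 1) :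
    IsDiff K (matProd αᴴ F α) := by
  obtain ⟨c, x, y, hc, rfl⟩ := hF
  exact ⟨c, ⟨_, hK.compress_mem x.2 hα⟩, ⟨_, hK.compress_mem y.2 hα⟩, hc,
    by rw [matProd_smul, matProd_sub]⟩

lemma IsNormLike.diffNorm_compress_le (hD : IsNormLike D) (hK : IsMatrixConvex K)
    {F : Matrix (Fin m) (Fin m) W} (hF : IsDiff K F) {α : Matrix (Fin m) (Fin n) ℂ}
    (hα : αᴴ * α = 1) : diffNorm D (matProd αᴴ F α) ≤ diffNorm D F := by
  obtain ⟨c, x, y, hc, rfl⟩ := hF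
  rw [hD.diffNorm_eq hK hc rfl, hD.diffNorm_eq hK (x := ⟨_, hK.compress_mem x.2 hα⟩)
    (y := ⟨_, hK.compress_mem y.2 hα⟩) hc (by rw [matProd_smul, matProd_sub])]
  exact mul_le_mul_of_nonneg_left
    (hD.isMatrixMetric.compress_le m n x y α _ _ hα rfl rfl) hc

/-- The compression axiom needs an isometry. The stack of `α` on `δ` is one, and it compresses `F ⊕
0` to `α*Fα`. -/
lemma IsNormLike.diffNorm_conj_le (hD : IsNormLike D) (hK : IsMatrixConvex K)
    (hne : (K 1).Nonempty) {F : Matrix (Fin m) (Fin m) W} (hF : IsDiff K F)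
    {α : Matrix (Fin m) (Fin n) ℂ} {δ : Matrix (Fin n) (Fin n) ℂ} (hα : αᴴ * α + δᴴ * δ = 1) :
    diffNorm D (matProd αᴴ F α) ≤ diffNorm D F := by
  obtain ⟨z, hz⟩ := hK.nonempty hne n
  have h0 : IsDiff K (0 : Matrix (Fin n) (Fin n) W) :=
    ⟨0, ⟨z, hz⟩, ⟨z, hz⟩, le_rfl, by simp⟩
  have h0' : diffNorm D (0 : Matrix (Fin n) (Fin n) W) = 0 := by
    rw [hD.diffNorm_eq hK (c := 0) (x := ⟨z, hz⟩) (y := ⟨z, hz⟩) le_rfl (by simp), zero_mul]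
  have h1 := hD.diffNorm_compress_le hK (hK.isDiff_dirSum hF h0) (α := colBlock α δ)
    (by rw [colBlock_conjTranspose_mul_self, hα])
  rw [hD.diffNorm_dirSum hK hF h0, h0', max_eq_left (hD.diffNorm_nonneg F),
    matProd_colBlock_dirSum] at h1
  have h2 : matProd δᴴ (0 : Matrix (Fin n) (Fin n) W) δ = 0 := by
    ext i j
    simp [matProd_apply]
  rwa [h2, add_zero] at h1

lemma IsNormLike.diffNorm_submatrix_le (hD : IsNormLike D) (hK : IsMatrixConvex K)
    {F : Matrix (Fin m) (Fin m) W} (hF : IsDiff K F) (e : Fin n ≃ Fin m) :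
    IsDiff K (F.submatrix e e) ∧ diffNorm D (F.submatrix e e) ≤ diffNorm D F := by
  have h1 : ((1 : Matrix (Fin m) (Fin m) ℂ).submatrix id e)ᴴ =
      (1 : Matrix (Fin m) (Fin m) ℂ).submatrix e id := by
    rw [Matrix.conjTranspose_submatrix, Matrix.conjTranspose_one]
  have h2 : ((1 : Matrix (Fin m) (Fin m) ℂ).submatrix id e)ᴴ *
      (1 : Matrix (Fin m) (Fin m) ℂ).submatrix id e = 1 := by
    rw [h1]
    ext i j
    simp [Matrix.mul_apply, Matrix.one_apply, e.injective.eq_iff]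
  rw [← matProd_submatrix, ← h1]
  exact ⟨hK.isDiff_compress hF h2, hD.diffNorm_compress_le hK hF h2⟩

lemma IsNormLike.diffNorm_submatrix (hD : IsNormLike D) (hK : IsMatrixConvex K)
    {F : Matrix (Fin m) (Fin m) W} (hF : IsDiff K F) (e : Fin n ≃ Fin m) :
    diffNorm D (F.submatrix e e) = diffNorm D F := by
  obtain ⟨h1, h2⟩ := hD.diffNorm_submatrix_le hK hF e
  refine le_antisymm h2 ?_
  have h3 := (hD.diffNorm_submatrix_le hK h1 e.symm).2
  simpa using h3

end DiffNorm

/-! ### Extension to all matrices through self-adjoint blocks -/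

section InducedNorm

/-- Only an inequality, because the norm is `0` when `n = 0`. -/
lemma l2_opNorm_one_le (n : ℕ) : ‖(1 : Matrix (Fin n) (Fin n) ℂ)‖ ≤ 1 := by
  rw [← Matrix.diagonal_one, Matrix.l2_opNorm_diagonal]
  exact (pi_norm_le_iff_of_nonneg zero_le_one).2 fun _ => by simp

lemma l2_opNorm_le_one_of_isometry {m n : ℕ} {α : Matrix (Fin m) (Fin n) ℂ} (h : αᴴ * α = 1) :
    ‖α‖ ≤ 1 := by
  have h1 := Matrix.l2_opNorm_conjTranspose_mul_self α
  rw [h] at h1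
  have h2 := l2_opNorm_one_le n
  nlinarith [norm_nonneg α]

lemma exists_eq_norm_smul {m n : ℕ} (α : Matrix (Fin m) (Fin n) ℂ) :
    ∃ α' : Matrix (Fin m) (Fin n) ℂ, ‖α'‖ ≤ 1 ∧ α = ((‖α‖ : ℝ) : ℂ) • α' := by
  by_cases h : ‖α‖ = 0
  · exact ⟨0, by simp, by simp [norm_eq_zero.1 h]⟩
  · have hC : ((‖α‖ : ℝ) : ℂ) ≠ 0 := by exact_mod_cast h
    refine ⟨(((‖α‖ : ℝ) : ℂ))⁻¹ • α, ?_, by rw [smul_smul, mul_inv_cancel₀ hC, one_smul]⟩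
    rw [norm_smul, norm_inv, Complex.norm_real, norm_norm, inv_mul_cancel₀ h]

variable {U W : Type*} [AddCommGroup U] [Module ℂ U] [StarAddMonoid U] [StarModule ℂ U]
  [AddCommGroup W] [Module ℂ W] {K : ∀ n : ℕ, Set (Matrix (Fin n) (Fin n) W)}
  {D : ∀ n : ℕ, K n → K n → ℝ} {m n : ℕ}

lemma matProd_conjTranspose (α : Matrix (Fin n) (Fin m) ℂ) (v : Matrix (Fin m) (Fin m) U)
    (β : Matrix (Fin m) (Fin n) ℂ) : (matProd α v β)ᴴ = matProd βᴴ vᴴ αᴴ := by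
  ext i j
  simp only [Matrix.conjTranspose_apply, matProd_apply, star_sum, star_smul, star_mul']
  rw [Finset.sum_comm]
  simp only [mul_comm]

lemma matProd_map (ι : U →ₗ[ℂ] W) (α : Matrix (Fin n) (Fin m) ℂ) (v : Matrix (Fin m) (Fin m) U)
    (β : Matrix (Fin m) (Fin n) ℂ) : (matProd α v β).map ι = matProd α (v.map ι) β := by
  ext i j
  simp [matProd_apply]

lemma dirSum_map (ι : U →ₗ[ℂ] W) (v : Matrix (Fin m) (Fin m) U) (w : Matrix (Fin n) (Fin n) U) :
    (dirSum v w).map ι = dirSum (v.map ι) (w.map ι) := by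
  apply ext_blocks <;> intro i j <;> simp [-Fin.natAdd_eq_addNat, dirSum]

/-- The selfadjoint matrix `[[0, f], [f*, 0]]`. -/
def hermBlock (f : Matrix (Fin n) (Fin n) U) : Matrix (Fin (n + n)) (Fin (n + n)) U :=
  blockMat 0 f fᴴ 0

lemma hermBlock_conjTranspose (f : Matrix (Fin n) (Fin n) U) : (hermBlock f)ᴴ = hermBlock f := by
  apply ext_blocks <;> intro i j <;>
    simp [-Fin.natAdd_eq_addNat, hermBlock, Matrix.conjTranspose_apply]

lemma hermBlock_add (f g : Matrix (Fin n) (Fin n) U) :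
    hermBlock (f + g) = hermBlock f + hermBlock g := by
  apply ext_blocks <;> intro i j <;> simp [-Fin.natAdd_eq_addNat, hermBlock]

lemma hermBlock_smul (t : ℝ) (f : Matrix (Fin n) (Fin n) U) :
    hermBlock ((t : ℂ) • f) = (t : ℂ) • hermBlock f := by
  apply ext_blocks <;> intro i j <;>
    simp [-Fin.natAdd_eq_addNat, -Complex.coe_smul, hermBlock, Matrix.conjTranspose_apply]

/-- This turns a product with unrelated factors `α` and `β` into a conjugation, the kind of
operation that a matrix metric controls. -/
lemma hermBlock_matProd (α : Matrix (Fin n) (Fin m) ℂ) (v : Matrix (Fin m) (Fin m) U)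
    (β : Matrix (Fin m) (Fin n) ℂ) :
    hermBlock (matProd α v β) = matProd (diagBlock αᴴ β)ᴴ (hermBlock v) (diagBlock αᴴ β) := by
  have h0 : ∀ {p q : ℕ} (γ : Matrix (Fin q) (Fin p) ℂ) (δ : Matrix (Fin p) (Fin q) ℂ),
      matProd γ (0 : Matrix (Fin p) (Fin p) U) δ = 0 := by
    intro p q γ δ
    ext i j
    simp [matProd_apply]
  rw [diagBlock_conjTranspose, hermBlock, hermBlock, matProd_diagBlock,
    Matrix.conjTranspose_conjTranspose, matProd_conjTranspose, h0, h0]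

lemma hermBlock_star (f : Matrix (Fin n) (Fin n) U) :
    hermBlock fᴴ = (hermBlock f).submatrix (finAddFlip (m := n) (n := n)) finAddFlip := by
  apply ext_blocks <;> intro i j <;> simp [-Fin.natAdd_eq_addNat, hermBlock]

/-- The exchange of the two middle summands. -/
def finAddAddComm (m n : ℕ) : Fin ((m + n) + (m + n)) ≃ Fin ((m + m) + (n + n)) :=
  finSumFinEquiv.symm.trans <| (Equiv.sumCongr finSumFinEquiv.symm finSumFinEquiv.symm).trans <|
    (Equiv.sumSumSumComm _ _ _ _).trans <|
      (Equiv.sumCongr finSumFinEquiv finSumFinEquiv).trans finSumFinEquiv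

lemma hermBlock_dirSum (f : Matrix (Fin m) (Fin m) U) (g : Matrix (Fin n) (Fin n) U) :
    hermBlock (dirSum f g) =
      (dirSum (hermBlock f) (hermBlock g)).submatrix (finAddAddComm m n) (finAddAddComm m n) := by
  apply ext_blocks <;> intro i j <;>
    refine Fin.addCases (fun i => ?_) (fun i => ?_) i <;>
    refine Fin.addCases (fun j => ?_) (fun j => ?_) j <;>
    simp [-Fin.natAdd_eq_addNat, hermBlock, dirSum, finAddAddComm, Matrix.conjTranspose_apply]

/-- `ι` identifies the selfadjoint matrices over `U` with the multiples of differences of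
elements of `K`. -/
structure IsDiffEmbedding (K : ∀ n : ℕ, Set (Matrix (Fin n) (Fin n) W)) (ι : U →ₗ[ℂ] W) :
    Prop where
  injective : Function.Injective ι
  isDiff : ∀ {n : ℕ} {f : Matrix (Fin n) (Fin n) U}, fᴴ = f → IsDiff K (f.map ι)
  exists_map_eq : ∀ {n : ℕ} (x y : K n), ∃ f : Matrix (Fin n) (Fin n) U,
    fᴴ = f ∧ f.map ι = x.1 - y.1

lemma IsDiffEmbedding.map_injective {ι : U →ₗ[ℂ] W} (hι : IsDiffEmbedding K ι) :
    Function.Injective fun f : Matrix (Fin n) (Fin n) U => f.map ι :=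
  Matrix.map_injective hι.injective

/-- The norm of `[[0, f], [f*, 0]]` determined by the metrics `D`. -/
noncomputable def inducedNorm (D : ∀ n : ℕ, K n → K n → ℝ) (ι : U →ₗ[ℂ] W) (n : ℕ)
    (f : Matrix (Fin n) (Fin n) U) : ℝ :=
  diffNorm D ((hermBlock f).map ι)

variable {ι : U →ₗ[ℂ] W}

lemma IsDiffEmbedding.isDiff_hermBlock (hι : IsDiffEmbedding K ι) (f : Matrix (Fin n) (Fin n) U) :
    IsDiff K ((hermBlock f).map ι) := hι.isDiff (hermBlock_conjTranspose f)

/-- Compression by the Hadamard unitary leads from `f ⊕ (-f)` to `[[0, f], [f, 0]]` and back, so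
both have the same norm; the first has that of `f` since `D` is symmetric. -/
lemma inducedNorm_of_selfadjoint (hD : IsNormLike D) (hK : IsMatrixConvex K)
    (hι : IsDiffEmbedding K ι) {f : Matrix (Fin n) (Fin n) U} (hf : fᴴ = f) :
    inducedNorm D ι n f = diffNorm D (f.map ι) := by
  have hH : (hadamard n)ᴴ * hadamard n = 1 := by rw [hadamard_conjTranspose, hadamard_mul_self]
  have hd := hι.isDiff hf
  have h0 : (hermBlock f).map ι = blockMat 0 (f.map ι) (f.map ι) 0 := by
    rw [hermBlock, hf]
    apply ext_blocks <;> intro i j <;> simp [-Fin.natAdd_eq_addNat]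
  have h1 := hK.isDiff_dirSum hd hd.neg
  have h2 : diffNorm D (dirSum (f.map ι) (-f.map ι)) = diffNorm D (f.map ι) := by
    rw [hD.diffNorm_dirSum hK hd hd.neg, hD.diffNorm_neg hK hd, max_self]
  have h3 := hD.diffNorm_compress_le hK h1 hH
  have h4 := hK.isDiff_compress h1 hH
  rw [matProd_hadamard] at h3 h4
  have h5 := hD.diffNorm_compress_le hK h4 hH
  rw [matProd_hadamard_offDiag] at h5
  rw [inducedNorm, h0, ← h2]
  exact le_antisymm h3 h5

lemma inducedNorm_star (hD : IsNormLike D) (hK : IsMatrixConvex K) (hι : IsDiffEmbedding K ι)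
    (f : Matrix (Fin n) (Fin n) U) : inducedNorm D ι n fᴴ = inducedNorm D ι n f := by
  rw [inducedNorm, inducedNorm, hermBlock_star, ← Matrix.submatrix_map]
  exact hD.diffNorm_submatrix hK (hι.isDiff_hermBlock f) _

lemma inducedNorm_real_smul (hD : IsNormLike D) (hK : IsMatrixConvex K)
    (hι : IsDiffEmbedding K ι) (f : Matrix (Fin n) (Fin n) U) {t : ℝ} (ht : 0 ≤ t) :
    inducedNorm D ι n ((t : ℂ) • f) = t * inducedNorm D ι n f := by
  rw [inducedNorm, inducedNorm, hermBlock_smul, Matrix.map_smul ι (t : ℂ) (map_smul ι _),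
    hD.diffNorm_smul hK (hι.isDiff_hermBlock f) ht]

lemma inducedNorm_matProd_le_of_le_one (hD : IsNormLike D) (hK : IsMatrixConvex K)
    (hne : (K 1).Nonempty) (hι : IsDiffEmbedding K ι) {α : Matrix (Fin n) (Fin m) ℂ}
    (hα : ‖α‖ ≤ 1) (v : Matrix (Fin m) (Fin m) U) {β : Matrix (Fin m) (Fin n) ℂ} (hβ : ‖β‖ ≤ 1) :
    inducedNorm D ι n (matProd α v β) ≤ inducedNorm D ι m v := by
  obtain ⟨δ, hδ⟩ := exists_dilation αᴴ (by rwa [Matrix.l2_opNorm_conjTranspose])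
  obtain ⟨ε, hε⟩ := exists_dilation β hβ
  rw [inducedNorm, inducedNorm, hermBlock_matProd, matProd_map]
  -- The defects of `α*` and `β`, placed on the diagonal, form a defect of `diag(α*, β)`.
  refine hD.diffNorm_conj_le hK hne (hι.isDiff_hermBlock v) (δ := diagBlock δ ε) ?_
  rw [diagBlock_conjTranspose, diagBlock_conjTranspose, diagBlock_mul, diagBlock_mul, diagBlock_add,
    hδ, hε, diagBlock_one]

lemma inducedNorm_matProd_le (hD : IsNormLike D) (hK : IsMatrixConvex K)
    (hne : (K 1).Nonempty) (hι : IsDiffEmbedding K ι) (α : Matrix (Fin n) (Fin m) ℂ)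
    (v : Matrix (Fin m) (Fin m) U) (β : Matrix (Fin m) (Fin n) ℂ) :
    inducedNorm D ι n (matProd α v β) ≤ ‖α‖ * inducedNorm D ι m v * ‖β‖ := by
  obtain ⟨α', hα', hα⟩ := exists_eq_norm_smul α
  obtain ⟨β', hβ', hβ⟩ := exists_eq_norm_smul β
  have h1 : matProd α v β = ((‖α‖ * ‖β‖ : ℝ) : ℂ) • matProd α' v β' := by
    conv_lhs => rw [hα, hβ]
    rw [smul_matProd, matProd_smul_right, smul_smul, Complex.ofReal_mul]
  rw [h1, inducedNorm_real_smul hD hK hι _ (by positivity)]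
  have h2 := mul_le_mul_of_nonneg_left
    (inducedNorm_matProd_le_of_le_one hD hK hne hι hα' v hβ')
    (mul_nonneg (norm_nonneg α) (norm_nonneg β))
  linarith

lemma isMatrixNorm_inducedNorm (hD : IsNormLike D) (hK : IsMatrixConvex K)
    (hne : (K 1).Nonempty) (hι : IsDiffEmbedding K ι) : IsMatrixNorm (inducedNorm D ι) where
  nonneg n v := hD.diffNorm_nonneg _
  add_le n v w := by
    rw [inducedNorm, hermBlock_add, Matrix.map_add ι (map_add ι)]
    exact hD.diffNorm_add_le hK (hι.isDiff_hermBlock v) (hι.isDiff_hermBlock w)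
  -- The block `[[0, f], [f*, 0]]` is only real-linear in `f`, so a complex factor is absorbed into
  -- the scalar matrix `c1`.
  smul_le n c v := by
    have h1 : c • v = matProd (c • 1) v 1 := by rw [smul_matProd, matProd_one]
    have h2 : ‖c • (1 : Matrix (Fin n) (Fin n) ℂ)‖ ≤ ‖c‖ := by
      rw [norm_smul]
      exact mul_le_of_le_one_right (norm_nonneg c) (l2_opNorm_one_le n)
    have h3 : 0 ≤ inducedNorm D ι n v := hD.diffNorm_nonneg _
    rw [h1]
    refine (inducedNorm_matProd_le hD hK hne hι _ v _).trans ?_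
    refine (mul_le_of_le_one_right (by positivity) (l2_opNorm_one_le n)).trans ?_
    exact mul_le_mul_of_nonneg_right h2 h3
  eq_zero n v h := by
    have h1 := hD.eq_zero_of_diffNorm_eq_zero hK (hι.isDiff_hermBlock v) h
    ext i j
    have h2 := congrFun (congrFun h1 (Fin.castAdd n i)) (Fin.natAdd n j)
    refine hι.injective ?_
    simpa [-Fin.natAdd_eq_addNat, hermBlock] using h2
  dirSum_eq m n v w := by
    have h1 := hι.isDiff_hermBlock v
    have h2 := hι.isDiff_hermBlock w
    rw [inducedNorm, hermBlock_dirSum, ← Matrix.submatrix_map, dirSum_map,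
      hD.diffNorm_submatrix hK (hK.isDiff_dirSum h1 h2), hD.diffNorm_dirSum hK h1 h2]
    rfl
  matProd_le m n α v β := inducedNorm_matProd_le hD hK hne hι α v β

lemma IsMatrixNorm.smul_of_nonneg {Q : ∀ n : ℕ, Matrix (Fin n) (Fin n) U → ℝ}
    (hQ : IsMatrixNorm Q) (f : Matrix (Fin n) (Fin n) U) {t : ℝ} (ht : 0 ≤ t) :
    Q n ((t : ℂ) • f) = t * Q n f := by
  have hn : ‖(t : ℂ)‖ = t := by rw [Complex.norm_real, Real.norm_of_nonneg ht]
  refine le_antisymm ((hQ.smul_le n t f).trans_eq (by rw [hn])) ?_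
  rcases ht.eq_or_lt with rfl | h0
  · rw [zero_mul]
    exact hQ.nonneg _ _
  · have hC : (t : ℂ) ≠ 0 := by exact_mod_cast h0.ne'
    have h1 := hQ.smul_le n (t : ℂ)⁻¹ ((t : ℂ) • f)
    rw [smul_smul, inv_mul_cancel₀ hC, one_smul, norm_inv, hn] at h1
    calc t * Q n f ≤ t * (t⁻¹ * Q n ((t : ℂ) • f)) := mul_le_mul_of_nonneg_left h1 ht
      _ = Q n ((t : ℂ) • f) := by field_simp

/-- Interchanging the two groups of columns carries the block to `f ⊕ f*` and back. As right
multiplication by a permutation matrix it does not increase `Q`. -/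
lemma IsMatrixNorm.hermBlock_eq {Q : ∀ n : ℕ, Matrix (Fin n) (Fin n) U → ℝ}
    (hQ : IsMatrixNorm Q) (hstar : ∀ n f, Q n fᴴ = Q n f) (f : Matrix (Fin n) (Fin n) U) :
    Q (n + n) (hermBlock f) = Q n f := by
  set S : Matrix (Fin (n + n)) (Fin (n + n)) ℂ := (1 : Matrix _ _ ℂ).submatrix id finAddFlip with hS
  have hS1 : ‖S‖ ≤ 1 := l2_opNorm_le_one_of_isometry (by
    ext i j
    simp [hS, Matrix.mul_apply, Matrix.one_apply, finAddFlip.injective.eq_iff])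
  have hmul : ∀ v : Matrix (Fin (n + n)) (Fin (n + n)) U,
      Q (n + n) (v.submatrix id finAddFlip) ≤ Q (n + n) v := by
    intro v
    rw [← matProd_submatrix, ← hS]
    refine (hQ.matProd_le _ _ _ _ _).trans ?_
    rw [Matrix.submatrix_id_id]
    have h1 := l2_opNorm_one_le (n + n)
    have h2 := hQ.nonneg (n + n) v
    exact (mul_le_of_le_one_right (by positivity) hS1).trans (mul_le_of_le_one_left h2 h1)
  have h1 : hermBlock f = (dirSum f fᴴ).submatrix id finAddFlip := by
    apply ext_blocks <;> intro i j <;> simp [-Fin.natAdd_eq_addNat, hermBlock, dirSum]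
  have h2 : dirSum f fᴴ = (hermBlock f).submatrix id finAddFlip := by
    apply ext_blocks <;> intro i j <;> simp [-Fin.natAdd_eq_addNat, hermBlock, dirSum]
  have h3 : Q (n + n) (dirSum f fᴴ) = Q n f := by rw [hQ.dirSum_eq, hstar, max_self]
  refine le_antisymm ?_ ?_
  · rw [h1, ← h3]
    exact hmul _
  · rw [← h3, h2]
    exact hmul _

/-- The value at `f` equals the value at its self-adjoint block, which is a multiple of a
difference, where `D` prescribes the norm. -/
lemma IsMatrixNorm.eq_inducedNorm {Q : ∀ n : ℕ, Matrix (Fin n) (Fin n) U → ℝ}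
    (hQ : IsMatrixNorm Q) (hstar : ∀ n f, Q n fᴴ = Q n f) (hD : IsNormLike D)
    (hK : IsMatrixConvex K) (hι : IsDiffEmbedding K ι)
    (hQD : ∀ (n : ℕ) (x y : K n) (f : Matrix (Fin n) (Fin n) U), f.map ι = x.1 - y.1 →
      Q n f = D n x y) : Q = inducedNorm D ι := by
  funext n f
  rw [← hQ.hermBlock_eq hstar]
  obtain ⟨c, x, y, hc, h⟩ := hι.isDiff_hermBlock f
  obtain ⟨g, -, hg⟩ := hι.exists_map_eq x y
  have h1 : hermBlock f = (c : ℂ) • g := hι.map_injective (by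
    simp only
    rw [h, Matrix.map_smul ι (c : ℂ) (map_smul ι _), hg])
  rw [inducedNorm, hD.diffNorm_eq hK hc h, h1, hQ.smul_of_nonneg g hc, hQD _ x y g hg]

lemma inducedNorm_eq (hD : IsNormLike D) (hK : IsMatrixConvex K) (hι : IsDiffEmbedding K ι)
    (x y : K n) {f : Matrix (Fin n) (Fin n) U} (h : f.map ι = x.1 - y.1) :
    inducedNorm D ι n f = D n x y := by
  obtain ⟨g, hg, hg'⟩ := hι.exists_map_eq x y
  obtain rfl : f = g := hι.map_injective (h.trans hg'.symm)
  rw [inducedNorm_of_selfadjoint hD hK hι hg,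
    hD.diffNorm_eq hK (c := 1) (x := x) (y := y) zero_le_one (by simpa using h), one_mul]

/-- If `w = ty + (1-t)z`, then `x - w = t(x - y) + (1-t)(x - z)`; a difference of midpoints is half
the sum of the differences; balance is translation invariance. -/
lemma IsMatrixNorm.isNormLike {Q : ∀ n : ℕ, Matrix (Fin n) (Fin n) U → ℝ}
    (hQ : IsMatrixNorm Q) (hD : IsMatrixMetric D)
    (hex : ∀ {n : ℕ} (x y : K n), ∃ f : Matrix (Fin n) (Fin n) U, f.map ι = x.1 - y.1)
    (hQD : ∀ (n : ℕ) (x y : K n) (f : Matrix (Fin n) (Fin n) U), f.map ι = x.1 - y.1 →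
      Q n f = D n x y) : IsNormLike D where
  isMatrixMetric := hD
  isConvexMetric n x y z w t h0 h1 hw := by
    obtain ⟨f, hf⟩ := hex x y
    obtain ⟨g, hg⟩ := hex x z
    rw [← hQD n x y f hf, ← hQD n x z g hg, ← hQ.smul_of_nonneg f h0,
      ← hQ.smul_of_nonneg g (sub_nonneg.2 h1),
      ← hQD n x w ((t : ℂ) • f + ((1 - t : ℝ) : ℂ) • g) (by
        rw [Matrix.map_add ι (map_add ι), Matrix.map_smul ι _ (map_smul ι _),
          Matrix.map_smul ι _ (map_smul ι _), hf, hg, hw]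
        push_cast
        module)]
    exact hQ.add_le n _ _
  isMidpointBalanced n x y u v h := by
    obtain ⟨f, hf⟩ := hex x u
    rw [← hQD n x u f hf]
    refine hQD n y v f ?_
    have h1 : (x : Matrix (Fin n) (Fin n) W) + v = y + u := by
      have h2 := congrArg (fun z => (2 : ℂ) • z) h
      simpa [smul_smul] using h2
    rw [hf]
    exact sub_eq_sub_iff_add_eq_add.2 h1
  isMidpointConcave n x y u v p q hp hq := by
    obtain ⟨f, hf⟩ := hex x y
    obtain ⟨g, hg⟩ := hex u v
    rw [← hQD n x y f hf, ← hQD n u v g hg,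
      ← hQD n p q (((1 / 2 : ℝ) : ℂ) • (f + g)) (by
        rw [Matrix.map_smul ι _ (map_smul ι _), Matrix.map_add ι (map_add ι), hf, hg, hp, hq]
        push_cast
        module), hQ.smul_of_nonneg _ (by norm_num)]
    exact mul_le_mul_of_nonneg_left (hQ.add_le n _ _) (by norm_num)

end InducedNorm

/-! ### The dual of `V/ℂ1` inside the dual of `V`, and the theorem -/

section Quotient

variable {V : Type*} [AddCommGroup V] [Module ℂ V] [StarAddMonoid V] [StarModule ℂ V]
  [MatrixOrderUnitSpace V]

lemma quotStar_quotStar (x : ModScalars V) : quotStar (quotStar x) = x := by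
  obtain ⟨v, rfl⟩ := Submodule.Quotient.mk_surjective _ x
  rw [quotStar_mk, quotStar_mk, star_star]

/-- The involution `dualStar` of the dual of `V/ℂ1`. -/
noncomputable abbrev dualStarAddMonoid : StarAddMonoid (StrongDual ℂ (ModScalars V)) where
  star := dualStar
  star_involutive f := by
    ext x
    change conj (conj (f (quotStar (quotStar x)))) = f x
    rw [quotStar_quotStar, Complex.conj_conj]
  star_add f g := by
    ext x
    exact map_add conj (f (quotStar x)) (g (quotStar x))

-- With this involution the conjugate transpose of a matrix of functionals is `matDualStar` by
-- definition, so the abstract results on `fᴴ` apply.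
attribute [local instance] dualStarAddMonoid

lemma star_strongDual_apply (f : StrongDual ℂ (ModScalars V)) (x : ModScalars V) :
    star f x = conj (f (quotStar x)) := rfl

lemma dualStarModule : StarModule ℂ (StrongDual ℂ (ModScalars V)) where
  star_smul c f := by
    ext x
    exact map_mul conj c (f (quotStar x))

attribute [local instance] dualStarModule

variable (V) in
/-- The embedding of the dual of `V/ℂ1` into the dual of `V`. -/
noncomputable def pullback : StrongDual ℂ (ModScalars V) →ₗ[ℂ] StrongDual ℂ V where
  toFun f := ⟨(f : ModScalars V →ₗ[ℂ] ℂ) ∘ₗ (scalars V).mkQ,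
    f.continuous.comp (scalars V).isQuotientMap_mkQ.continuous⟩
  map_add' _ _ := rfl
  map_smul' _ _ := rfl

lemma pullback_injective : Function.Injective (pullback V) := by
  intro f g h
  ext x
  obtain ⟨v, rfl⟩ := Submodule.Quotient.mk_surjective _ x
  exact congrArg (fun k : StrongDual ℂ V => k v) h

lemma isMatrixConvex_matrixStates : IsMatrixConvex (matrixStates V) where
  convexComb_mem hx hy _ h0 h1 := convexComb_mem_matrixStates hx hy h0 h1
  dirSum_mem hx hy := dirSum_mem_matrixStates hx hy
  compress_mem hx hα := compress_mem_matrixStates hx hα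

lemma map_pullback_stateDiff {n : ℕ} (φ ψ : matrixStates V n) :
    (stateDiff φ ψ).map (pullback V) = φ.1 - ψ.1 := rfl

lemma stateDiff_conjTranspose {n : ℕ} (φ ψ : matrixStates V n) :
    (stateDiff φ ψ)ᴴ = stateDiff φ ψ := by
  have h : ∀ (φ : matrixStates V n) (i j : Fin n) (v : V),
      conj (φ.1 j i (star v)) = φ.1 i j v := fun φ i j v => by
    rw [← matAdj_apply, (mem_matrixStates_iff.1 φ.2).1.matAdj_eq]
  ext i j x
  obtain ⟨v, rfl⟩ := Submodule.Quotient.mk_surjective _ x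
  rw [Matrix.conjTranspose_apply, star_strongDual_apply, quotStar_mk, stateDiff_apply,
    stateDiff_apply, map_sub, h, h]

lemma isDiffEmbedding_pullback (hne : (matrixStates V 1).Nonempty) :
    IsDiffEmbedding (matrixStates V) (pullback V) where
  injective := pullback_injective
  isDiff {n f} hf := by
    refine exists_eq_smul_sub ?_ ?_ hne
    · ext i j v
      conv_rhs => rw [← hf]
      rfl
    · ext i j
      have h0 : (Submodule.Quotient.mk MatrixOrderUnitSpace.unit : ModScalars V) = 0 :=
        (Submodule.Quotient.mk_eq_zero _).2 (Submodule.mem_span_singleton_self _)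
      change f i j (Submodule.Quotient.mk MatrixOrderUnitSpace.unit) = 0
      rw [h0, map_zero]
  exists_map_eq φ ψ := ⟨stateDiff φ ψ, stateDiff_conjTranspose φ ψ, map_pullback_stateDiff φ ψ⟩

variable {D : ∀ n : ℕ, matrixStates V n → matrixStates V n → ℝ}
  {Q : ∀ n : ℕ, Matrix (Fin n) (Fin n) (StrongDual ℂ (ModScalars V)) → ℝ}

lemma IsNormInducing.eq_of_map_pullback (hQ : IsNormInducing D Q) (n : ℕ)
    (φ ψ : matrixStates V n) (f : Matrix (Fin n) (Fin n) (StrongDual ℂ (ModScalars V)))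
    (h : f.map (pullback V) = φ.1 - ψ.1) : Q n f = D n φ ψ := by
  rw [Matrix.map_injective pullback_injective (h.trans (map_pullback_stateDiff φ ψ).symm),
    hQ.stateDiff_eq]

lemma IsNormInducing.isNormLike (hQ : IsNormInducing D Q) (hD : IsMatrixMetric D) :
    IsNormLike D :=
  hQ.isMatrixNorm.isNormLike hD
    (fun φ ψ => ⟨stateDiff φ ψ, map_pullback_stateDiff φ ψ⟩) hQ.eq_of_map_pullback

lemma isNormInducing_inducedNorm (hD : IsNormLike D) (hne : (matrixStates V 1).Nonempty) :
    IsNormInducing D (inducedNorm D (pullback V)) where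
  isMatrixNorm := isMatrixNorm_inducedNorm hD isMatrixConvex_matrixStates hne
    (isDiffEmbedding_pullback hne)
  stateDiff_eq _ φ ψ := inducedNorm_eq hD isMatrixConvex_matrixStates
    (isDiffEmbedding_pullback hne) φ ψ (map_pullback_stateDiff φ ψ)
  star_eq _ f := inducedNorm_star hD isMatrixConvex_matrixStates
    (isDiffEmbedding_pullback hne) f

lemma IsNormInducing.eq_inducedNorm (hQ : IsNormInducing D Q) (hD : IsMatrixMetric D)
    (hne : (matrixStates V 1).Nonempty) : Q = inducedNorm D (pullback V) :=
  hQ.isMatrixNorm.eq_inducedNorm hQ.star_eq (hQ.isNormLike hD) isMatrixConvex_matrixStates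
    (isDiffEmbedding_pullback hne) hQ.eq_of_map_pullback

lemma matrix_eq_zero_of_no_states (hne : ¬(matrixStates V 1).Nonempty) {n : ℕ}
    (f : Matrix (Fin n) (Fin n) (StrongDual ℂ (ModScalars V))) : f = 0 := by
  refine Matrix.ext fun i j => ?_
  exact pullback_injective ((strongDual_eq_zero_of_no_states hne _).trans (map_zero _).symm)

lemma isNormInducing_zero (hD : IsMatrixMetric D) (hne : ¬(matrixStates V 1).Nonempty) :
    IsNormInducing D (fun _ _ => 0) where
  isMatrixNorm :=
    { nonneg := fun _ _ => le_rfl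
      add_le := fun _ _ _ => by simp
      smul_le := fun _ _ _ => by simp
      eq_zero := fun _ v _ => matrix_eq_zero_of_no_states hne v
      dirSum_eq := fun _ _ _ _ => by simp
      matProd_le := fun _ _ _ _ _ => by simp }
  stateDiff_eq n φ ψ := by
    have h : φ = ψ := Subtype.ext (by
      refine Matrix.ext fun i j => ?_
      exact (strongDual_eq_zero_of_no_states hne _).trans
        (strongDual_eq_zero_of_no_states hne _).symm)
    rw [h, (hD.isMetric n).self_eq_zero]
  star_eq _ _ := rfl

lemma IsMatrixNorm.eq_zero_of_no_states (hQ : IsMatrixNorm Q)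
    (hne : ¬(matrixStates V 1).Nonempty) : Q = fun _ _ => 0 := by
  funext n f
  refine le_antisymm ?_ (hQ.nonneg n f)
  have h := hQ.smul_le n 0 f
  rw [norm_zero, zero_mul] at h
  rwa [matrix_eq_zero_of_no_states hne (_ • f), ← matrix_eq_zero_of_no_states hne f] at h

end Quotient

theorem theorem5p5 {V : Type*} [AddCommGroup V] [Module ℂ V] [StarAddMonoid V] [StarModule ℂ V]
    [MatrixOrderUnitSpace V] (D : ∀ n : ℕ, matrixStates V n → matrixStates V n → ℝ)
    (hD : IsMatrixMetric D) :
    ((∃ Q : ∀ n : ℕ, Matrix (Fin n) (Fin n) (StrongDual ℂ (ModScalars V)) → ℝ,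
        IsNormInducing D Q) ↔
      (∀ n, IsConvexMetric (D n)) ∧ (∀ n, IsMidpointBalanced (D n)) ∧
        (∀ n, IsMidpointConcave (D n))) ∧
    (∀ Q Q' : ∀ n : ℕ, Matrix (Fin n) (Fin n) (StrongDual ℂ (ModScalars V)) → ℝ,
      IsNormInducing D Q → IsNormInducing D Q' → Q = Q') := by
  refine ⟨⟨?_, ?_⟩, ?_⟩
  · rintro ⟨Q, hQ⟩
    have h := hQ.isNormLike hD
    exact ⟨h.isConvexMetric, h.isMidpointBalanced, h.isMidpointConcave⟩
  · rintro ⟨h1, h2, h3⟩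
    -- States are absent for instance when `V = 0`. Then the dual is zero and the zero family is the
    -- only candidate.
    by_cases hne : (matrixStates V 1).Nonempty
    · exact ⟨_, isNormInducing_inducedNorm ⟨hD, h1, h2, h3⟩ hne⟩
    · exact ⟨_, isNormInducing_zero hD hne⟩
  · intro Q Q' hQ hQ'
    by_cases hne : (matrixStates V 1).Nonempty
    · rw [hQ.eq_inducedNorm hD hne, hQ'.eq_inducedNorm hD hne]
    · rw [hQ.isMatrixNorm.eq_zero_of_no_states hne, hQ'.isMatrixNorm.eq_zero_of_no_states hne]
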